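/- Let $n\ge 2$ be an integer and let $\gamma>0$, $L\ge 2\gamma$, $\tau>0$ be real; put $L_2=4L$. **Blocks and buffers.** Let $B_1=[0,\tau]\times[0,\tau]$, $B_2=[2\tau,3\tau]\times[0,\tau]$, $B'_1=[\tau,2\tau]\times[0,\tau]$, $B'_2=[2\tau,3\tau]\times[\tau,2\tau]$, and $B_i=B_{i-2}+(2\tau,2\tau)$, $B'_i=B'_{i-2}+(2\tau,2\tau)$ for $i\ge 3$. Let $(a^i,b^i)$ be the lower left corner and $s^i=(s^i_1,s^i_2)=(a^i+\tau/2,\,b^i+\tau/2)$ the center of $B_i$, and let $D=\bigcup_{i=1}^{n}B_i\cup\bigcup_{i=1}^{n-1}B'_i$. **Auxiliary functions.** Let $p(u)=\tfrac12(\gamma-L)u^2+(L\tau-2\gamma\tau)u$, $g_1(u)=p(u)-p(\tau)-\tfrac14\gamma\tau^2$, $\nu=\tfrac14L\tau^2-g_1(2\tau)$, and $$g_2(u;c_1,c_2)=c_2-\frac{10(c_1-c_2)(u-2\tau)^3}{\tau^3}-\frac{15(c_1-c_2)(u-2\tau)^4}{\tau^4}-\frac{6(c_1-c_2)(u-2\tau)^5}{\tau^5}.$$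 For $1\le i\le n-1$ let $g^{(i)}(u,w)=g_1(u)+g_2(u;L,c)\,w^2$, where $c=L$ if $i=n-1$, and for $i<n-1$, $c=L_2$ if $w<0$ and $c=-\gamma$ if $w\ge0$. **The function.** On $D$ the function $f$ is given by: * on $B_i$, $i<n$ odd: $f(x)=-i\nu+\kappa(x_1-s^i_1)^2+L(x_2-s^i_2)^2$, with $\kappa=-\gamma$ if $x_1>s^i_1$ and $\kappa=L_2$ if $x_1\le s^i_1$; * on $B_i$, $i<n$ even: $f(x)=-i\nu+L(x_1-s^i_1)^2+\kappa(x_2-s^i_2)^2$, with $\kappa=-\gamma$ if $x_2>s^i_2$ and $\kappa=L_2$ if $x_2\le s^i_2$; * on $B_n$: $f(x)=-n\nu+L(x_1-s^n_1)^2+L(x_2-s^n_2)^2$; * on $B'_i$, $i<n$ odd: $f(x)=-i\nu+g^{(i)}(x_1-a^i,\;x_2-s^i_2)$; * on $B'_i$, $i<n$ even: $f(x)=-i\nu+g^{(i)}(x_2-b^i,\;x_1-s^i_1)$; and $f$ is extended to $\mathbb R^2$ as a differentiable function with Lipschitz gradient. **Theorem.** There is an absolute constant $c>0$ such that for all $n\ge2$,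 $\tau>0$, $\gamma>0$ and $L\ge2\gamma$ such an extension $f:\mathbb R^2\to\mathbb R$ exists, and every such $f$ has the following properties. 1. The centers $s^1,\dots,s^{n-1}$ are saddle points of $f$ (stationary points that are neither local minima nor local maxima), and $s^n$ is the only point of $D$ at which $f$ has a local minimum. 2. Let $x^{t+1}=x^t-\eta\nabla f(x^t)$ be the iterates of gradient descent with step size $\eta=\frac1{4L}$, where $x^0\in B_1$ and $d_1^0=|x^0_1-s^1_1|\le\frac{\tau}{2e^2}$. Then $x^t\in D$ for all $t$, and every $t$ with $x^t\in B_n$ satisfies $$t\;\ge\;c\,\frac{\gamma}{L}\Big(\frac L\gamma\Big)^{n}.$$ In particular, for fixed $L$ and $\gamma$, gradient descent needs $\Omega\big((L/\gamma)^n\big)$ iterations to reach the block containing the local minimum, uniformly in $\tau$, in the extension and in the initial point. -/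

import Mathlib

noncomputable section

namespace Staircase

/-- The Euclidean plane; `x 0` and `x 1` are the coordinates written `x₁` and `x₂` on paper. -/
abbrev Plane := EuclideanSpace ℝ (Fin 2)

/-! ### Blocks and buffers (numbered from `i = 1`) -/

/-- First coordinate of the lower left corner of block `i`: `0, 2τ, 2τ, 4τ, 4τ, …`. -/
def left (τ : ℝ) (i : ℕ) : ℝ := 2 * τ * ((i / 2 : ℕ) : ℝ)

/-- Second coordinate of the lower left corner of block `i`: `0, 0, 2τ, 2τ, 4τ, …`. -/
def bottom (τ : ℝ) (i : ℕ) : ℝ := 2 * τ * (((i - 1) / 2 : ℕ) : ℝ)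

/-- First coordinate of the center of block `i`. -/
def s₁ (τ : ℝ) (i : ℕ) : ℝ := left τ i + τ / 2

/-- Second coordinate of the center of block `i`. -/
def s₂ (τ : ℝ) (i : ℕ) : ℝ := bottom τ i + τ / 2

/-- The center of block `i`. -/
def center (τ : ℝ) (i : ℕ) : Plane := !₂[s₁ τ i, s₂ τ i]

/-- The block `B_i`: `B_1 = [0,τ] × [0,τ]`, `B_2 = [2τ,3τ] × [0,τ]`, `B_i = B_{i-2} + (2τ,2τ)`. -/
def block (τ : ℝ) (i : ℕ) : Set Plane :=
  {x | x 0 ∈ Set.Icc (left τ i) (left τ i + τ) ∧ x 1 ∈ Set.Icc (bottom τ i) (bottom τ i + τ)}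

open Classical in
/-- The buffer `B'_i`, to the right of an odd block and on top of an even block:
`B'_1 = [τ,2τ] × [0,τ]`, `B'_2 = [2τ,3τ] × [τ,2τ]`, `B'_i = B'_{i-2} + (2τ,2τ)`. -/
def buffer (τ : ℝ) (i : ℕ) : Set Plane :=
  if Odd i then
    {x | x 0 ∈ Set.Icc (left τ i + τ) (left τ i + 2 * τ) ∧
      x 1 ∈ Set.Icc (bottom τ i) (bottom τ i + τ)}
  else
    {x | x 0 ∈ Set.Icc (left τ i) (left τ i + τ) ∧
      x 1 ∈ Set.Icc (bottom τ i + τ) (bottom τ i + 2 * τ)}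

/-- The region `D`: the blocks `B_1, …, B_n` and the buffers `B'_1, …, B'_{n-1}` between them. -/
def region (τ : ℝ) (n : ℕ) : Set Plane :=
  {x | (∃ i, 1 ≤ i ∧ i ≤ n ∧ x ∈ block τ i) ∨ (∃ i, 1 ≤ i ∧ i < n ∧ x ∈ buffer τ i)}

/-! ### The objective on the region -/

/-- The quadratic `p`. -/
def p (γ L τ u : ℝ) : ℝ := (1 / 2) * (γ - L) * u ^ 2 + (L * τ - 2 * γ * τ) * u

/-- The buffer profile `g₁`. -/
def g₁ (γ L τ u : ℝ) : ℝ := p γ L τ u - p γ L τ τ - (1 / 4) * γ * τ ^ 2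

/-- The drop `ν` between consecutive blocks. -/
def ν (γ L τ : ℝ) : ℝ := (1 / 4) * L * τ ^ 2 - g₁ γ L τ (2 * τ)

/-- The interpolant `g₂(u; c₁, c₂)`, equal to `c₁` at `u = τ` and to `c₂` at `u = 2τ`. -/
def g₂ (τ c₁ c₂ u : ℝ) : ℝ :=
  c₂ - 10 * (c₁ - c₂) * (u - 2 * τ) ^ 3 / τ ^ 3 - 15 * (c₁ - c₂) * (u - 2 * τ) ^ 4 / τ ^ 4
    - 6 * (c₁ - c₂) * (u - 2 * τ) ^ 5 / τ ^ 5

open Classical in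
/-- The formula for the objective on block `i` out of `n`, with `L₂ = 4L`. -/
def blockFun (γ L τ : ℝ) (n i : ℕ) (x : Plane) : ℝ :=
  -(i : ℝ) * ν γ L τ +
    if i = n then
      L * (x 0 - s₁ τ i) ^ 2 + L * (x 1 - s₂ τ i) ^ 2
    else if Odd i then
      (if s₁ τ i < x 0 then -γ else 4 * L) * (x 0 - s₁ τ i) ^ 2 + L * (x 1 - s₂ τ i) ^ 2
    else
      L * (x 0 - s₁ τ i) ^ 2 + (if s₂ τ i < x 1 then -γ else 4 * L) * (x 1 - s₂ τ i) ^ 2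

open Classical in
/-- The buffer function in local coordinates: `u` runs through `[τ, 2τ]` across the buffer, and
`w` is the signed distance to the center line of the buffer.  The curvature along the transversal
direction goes from `L` to the one of the next block, which is `L` if the next block is the final
one, and otherwise `L₂ = 4L` for `w < 0` and `-γ` for `w ≥ 0`. -/
def g (γ L τ : ℝ) (nextIsFinal : Prop) (u w : ℝ) : ℝ :=
  g₁ γ L τ u +
    g₂ τ L (if nextIsFinal then L else if w < 0 then 4 * L else -γ) u * w ^ 2

open Classical in
/-- The formula for the objective on the buffer that follows block `i`, out of `n` blocks. -/
def bufferFun (γ L τ : ℝ) (n i : ℕ) (x : Plane) : ℝ :=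
  -(i : ℝ) * ν γ L τ +
    if Odd i then
      g γ L τ (i + 1 = n) (x 0 - left τ i) (x 1 - s₂ τ i)
    else
      g γ L τ (i + 1 = n) (x 1 - bottom τ i) (x 0 - s₁ τ i)

/-- `f` is the constructed function on `D`, extended to the plane as a differentiable function with
Lipschitz gradient. -/
structure IsObjective (γ L τ : ℝ) (n : ℕ) (f : Plane → ℝ) : Prop where
  differentiable : Differentiable ℝ f
  lipschitz_gradient : ∃ K, LipschitzWith K (gradient f)
  eq_on_block : ∀ i, 1 ≤ i → i ≤ n → ∀ x ∈ block τ i, f x = blockFun γ L τ n i x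
  eq_on_buffer : ∀ i, 1 ≤ i → i < n → ∀ x ∈ buffer τ i, f x = bufferFun γ L τ n i x

/-! ### Saddle points and gradient descent -/

/-- A saddle point: a stationary point that is neither a local minimum nor a local maximum. -/
def IsSaddlePoint (f : Plane → ℝ) (z : Plane) : Prop :=
  gradient f z = 0 ∧ ¬ IsLocalMin f z ∧ ¬ IsLocalMax f z

/-- `x 0, x 1, x 2, …` are the iterates of gradient descent on `f` with step size `η`. -/
def IsGradientDescent (f : Plane → ℝ) (η : ℝ) (x : ℕ → Plane) : Prop :=
  ∀ t, x (t + 1) = x t - η • gradient f (x t)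

end Staircase

end

open Staircase

/-!
In units where `τ = L = 1`, with `ρ = γ / L ≤ 1 / 2`, blocks `k + 1` and `k + 2` and the buffer
between them form a strip of size `3 × 1`, with a coordinate `u = crd τ k` along it and a coordinate
`v = crd τ (k + 1)` across it.  On the whole strip the objective is `stripFun`, that is
`P u + P (v + 2) + ε * S u * C v` up to a constant: `P` is a `C^{1,1}` profile (`prof`), `S` the
smoothstep (`step`), `C v = P v - P (v + 2) - const` (`corr`), and `ε = 0` exactly before the final
block.

*Extension.*  The sum `P (crd 0) + P (crd 1 + 2) + ∑ j, S (crd j) * C (crd (j + 1))` makes sense on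
the whole plane.  On a strip each `S (crd j)` of an earlier strip is `1` and each one of a later
strip is `0`, so that the sum telescopes to `stripFun` (`extension_eq_stripFun`).  Its gradient is
Lipschitz because the functions `S`, `C` and their derivatives are bounded and Lipschitz, as is the
derivative of `P`.

*Critical points.*  A strip is convex with nonempty interior, so the gradient of every objective at
every point of a strip, boundary included, is the one of `stripFun` (`IsObjective.gradient_eq`).
It vanishes only at the centers of the blocks.

*Gradient descent.*  With step size `1 / (4L)`, in a block before the final one the offset across
the strip is halved in each step, and the offset along the strip grows by a factor of at most
`1 + ρ / 2`.  A buffer is passed in at most `5 / ρ + 1` steps, in which the offset across the strip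
grows by at most `1 + ρ / 2` per step.  On leaving a buffer the two directions exchange their roles.
If the stay in a block takes `N` steps, then the next block is entered with an offset of about
`2 ^ (-N)` in its unstable direction, and it takes about `2 * log 2 * N / ρ > N / ρ` steps to leave
it.  Since `2 * log 2 > 1.38`, the surplus pays for the growth in the buffers, and the stay in block
`k + 1` takes at least `ρ ^ (-(k + 1)) + 6` steps (`wait`); the recursion is `exponent_le`.  The
invariant `Inv` records this for each iterate.  An iterate without any offset in the
unstable direction of a block stays in this block forever, which the invariant allows.
-/

noncomputable section

namespace Staircase

variable {γ L τ : ℝ}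

/-! ### The one-dimensional profiles -/

/-- The positive part of a real number. -/
def ramp (t : ℝ) : ℝ := max t 0

lemma ramp_of_nonneg {t : ℝ} (h : 0 ≤ t) : ramp t = t := max_eq_left h

lemma ramp_of_nonpos {t : ℝ} (h : t ≤ 0) : ramp t = 0 := max_eq_right h

lemma hasDerivAt_ramp_sq (t : ℝ) : HasDerivAt (fun t => ramp t ^ 2) (2 * ramp t) t := by
  rcases lt_trichotomy t 0 with h | h | h
  · rw [ramp_of_nonpos h.le, mul_zero]
    refine (hasDerivAt_const t (0 : ℝ)).congr_of_eventuallyEq ?_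
    filter_upwards [gt_mem_nhds h] with s hs
    simp [ramp_of_nonpos hs.le]
  · subst h
    rw [ramp_of_nonneg le_rfl, mul_zero, hasDerivAt_iff_isLittleO_nhds_zero]
    refine Asymptotics.IsBigO.trans_isLittleO (g := fun h : ℝ => h ^ 2) ?_ ?_
    · refine Asymptotics.IsBigO.of_bound 1 (Filter.Eventually.of_forall fun h => ?_)
      rcases le_total 0 h with h0 | h0
      · simp [ramp, h0]
      · simp [ramp, h0, sq_nonneg]
    · simpa using Asymptotics.isLittleO_pow_id (𝕜 := ℝ) (n := 2) (by norm_num)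
  · rw [ramp_of_nonneg h.le]
    have h1 : HasDerivAt (fun t : ℝ => t ^ 2) (2 * t) t := by simpa using hasDerivAt_pow 2 t
    refine h1.congr_of_eventuallyEq ?_
    filter_upwards [lt_mem_nhds h] with s hs
    simp [ramp_of_nonneg hs.le]

/-- The projection of `t` to the interval `[a, b]`, shifted to `[0, b - a]`. -/
def hat (a b t : ℝ) : ℝ := ramp (t - a) - ramp (t - b)

lemma hat_nonneg {a b : ℝ} (h : a ≤ b) (t : ℝ) : 0 ≤ hat a b t :=
  sub_nonneg.2 (max_le_max_right 0 (by linarith))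

lemma hat_le {a b : ℝ} (h : a ≤ b) (t : ℝ) : hat a b t ≤ b - a := by
  unfold hat ramp
  rcases max_cases (t - a) 0 with h1 | h1 <;> rcases max_cases (t - b) 0 with h2 | h2 <;> linarith

lemma abs_hat_sub_le {a b : ℝ} (h : a ≤ b) (s t : ℝ) : |hat a b s - hat a b t| ≤ |s - t| := by
  wlog hst : s ≤ t generalizing s t
  · rw [abs_sub_comm, abs_sub_comm s]
    exact this t s (le_of_not_ge hst)
  rw [abs_of_nonpos (sub_nonpos.2 hst), abs_le]
  unfold hat ramp
  constructor <;>
  rcases max_cases (t - a) 0 with h1 | h1 <;> rcases max_cases (t - b) 0 with h2 | h2 <;>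
  rcases max_cases (s - a) 0 with h3 | h3 <;> rcases max_cases (s - b) 0 with h4 | h4 <;> linarith

lemma hat_of_le {a b t : ℝ} (h : a ≤ b) (ht : t ≤ a) : hat a b t = 0 := by
  rw [hat, ramp_of_nonpos (by linarith), ramp_of_nonpos (by linarith), sub_zero]

lemma hat_of_mem {a b t : ℝ} (h : t ∈ Set.Icc a b) : hat a b t = t - a := by
  rw [hat, ramp_of_nonneg (by linarith [h.1]), ramp_of_nonpos (by linarith [h.2]), sub_zero]

lemma hat_of_ge {a b t : ℝ} (h : a ≤ b) (ht : b ≤ t) : hat a b t = b - a := by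
  rw [hat, ramp_of_nonneg (by linarith), ramp_of_nonneg (by linarith)]
  ring

/-- An antiderivative of `2 * hat a b`. -/
def hatInt (a b t : ℝ) : ℝ := ramp (t - a) ^ 2 - ramp (t - b) ^ 2

lemma hasDerivAt_hatInt (a b t : ℝ) : HasDerivAt (hatInt a b) (2 * hat a b t) t := by
  have h := ((hasDerivAt_ramp_sq (t - a)).comp_sub_const t a).sub
    ((hasDerivAt_ramp_sq (t - b)).comp_sub_const t b)
  exact h.congr_deriv (by unfold hat; ring)

lemma hatInt_of_le {a b t : ℝ} (h : a ≤ b) (ht : t ≤ a) : hatInt a b t = 0 := by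
  rw [hatInt, ramp_of_nonpos (by linarith), ramp_of_nonpos (by linarith), sub_self]

lemma hatInt_of_mem {a b t : ℝ} (h : t ∈ Set.Icc a b) : hatInt a b t = (t - a) ^ 2 := by
  rw [hatInt, ramp_of_nonneg (by linarith [h.1]), ramp_of_nonpos (by linarith [h.2])]
  ring

lemma hatInt_of_ge {a b t : ℝ} (h : a ≤ b) (ht : b ≤ t) :
    hatInt a b t = (t - a) ^ 2 - (t - b) ^ 2 := by
  rw [hatInt, ramp_of_nonneg (by linarith), ramp_of_nonneg (by linarith)]

/-- The profile of the objective along a block, the buffer behind it and the next block, for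
`τ = L = 1` and `γ = ρ`: a parabola of curvature coefficient `4`, then `-ρ`, on the two halves of
`[0, 1]`, the buffer profile on `[1, 2]`, and a parabola of coefficient `1` on `[2, 3]`.  It is
affine outside of `[0, 3]`. -/
def prof (ρ t : ℝ) : ℝ :=
  1 - 4 * t + 4 * hatInt 0 (1 / 2) t - ρ * hatInt (1 / 2) 1 t - (1 - ρ) / 2 * hatInt 1 2 t
    + hatInt 2 3 t

/-- The derivative of `prof`. -/
def dprof (ρ t : ℝ) : ℝ :=
  -4 + 8 * hat 0 (1 / 2) t - 2 * ρ * hat (1 / 2) 1 t - (1 - ρ) * hat 1 2 t + 2 * hat 2 3 t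

lemma hasDerivAt_prof (ρ t : ℝ) : HasDerivAt (prof ρ) (dprof ρ t) t := by
  have h := (((((hasDerivAt_const t (1 : ℝ)).sub ((hasDerivAt_id t).const_mul 4)).add
    ((hasDerivAt_hatInt 0 (1 / 2) t).const_mul 4)).sub
    ((hasDerivAt_hatInt (1 / 2) 1 t).const_mul ρ)).sub
    ((hasDerivAt_hatInt 1 2 t).const_mul ((1 - ρ) / 2))).add (hasDerivAt_hatInt 2 3 t)
  exact h.congr_deriv (by unfold dprof; ring)

/-- The coefficient of `(t - 1 / 2) ^ 2` in the profile at the point `t` of `[0, 1]`. -/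
def curv (ρ t : ℝ) : ℝ := if t ≤ 1 / 2 then 4 else -ρ

/-- The drop between consecutive blocks, for `τ = L = 1` and `γ = ρ`. -/
def drop (ρ : ℝ) : ℝ := 3 / 4 + 3 / 4 * ρ

lemma prof_of_mem_zero_one (ρ : ℝ) {t : ℝ} (h : t ∈ Set.Icc (0 : ℝ) 1) :
    prof ρ t = curv ρ t * (t - 1 / 2) ^ 2 := by
  obtain ⟨h0, h1⟩ := h
  unfold prof curv
  rw [hatInt_of_le (by norm_num : (1 : ℝ) ≤ 2) h1,
    hatInt_of_le (by norm_num : (2 : ℝ) ≤ 3) (by linarith)]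
  split_ifs with h
  · rw [hatInt_of_mem ⟨h0, h⟩, hatInt_of_le (by norm_num) h]
    ring
  · rw [hatInt_of_ge (by norm_num) (not_le.1 h).le, hatInt_of_mem ⟨(not_le.1 h).le, h1⟩]
    ring

lemma dprof_of_mem_zero_one (ρ : ℝ) {t : ℝ} (h : t ∈ Set.Icc (0 : ℝ) 1) :
    dprof ρ t = 2 * curv ρ t * (t - 1 / 2) := by
  obtain ⟨h0, h1⟩ := h
  unfold dprof curv
  rw [hat_of_le (by norm_num : (1 : ℝ) ≤ 2) h1,
    hat_of_le (by norm_num : (2 : ℝ) ≤ 3) (by linarith)]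
  split_ifs with h
  · rw [hat_of_mem ⟨h0, h⟩, hat_of_le (by norm_num) h]
    ring
  · rw [hat_of_ge (by norm_num) (not_le.1 h).le, hat_of_mem ⟨(not_le.1 h).le, h1⟩]
    ring

lemma prof_of_mem_one_two (ρ : ℝ) {t : ℝ} (h : t ∈ Set.Icc (1 : ℝ) 2) :
    prof ρ t = -ρ / 4 - ρ * (t - 1) - (1 - ρ) / 2 * (t - 1) ^ 2 := by
  obtain ⟨h0, h1⟩ := h
  unfold prof
  rw [hatInt_of_ge (by norm_num) (by linarith), hatInt_of_ge (by norm_num) h0,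
    hatInt_of_mem ⟨h0, h1⟩, hatInt_of_le (by norm_num) h1]
  ring

lemma dprof_of_mem_one_two (ρ : ℝ) {t : ℝ} (h : t ∈ Set.Icc (1 : ℝ) 2) :
    dprof ρ t = -ρ - (1 - ρ) * (t - 1) := by
  obtain ⟨h0, h1⟩ := h
  unfold dprof
  rw [hat_of_ge (by norm_num) (by linarith), hat_of_ge (by norm_num) h0,
    hat_of_mem ⟨h0, h1⟩, hat_of_le (by norm_num) h1]
  ring

lemma prof_of_mem_two_three (ρ : ℝ) {t : ℝ} (h : t ∈ Set.Icc (2 : ℝ) 3) :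
    prof ρ t = (t - 5 / 2) ^ 2 - drop ρ := by
  obtain ⟨h0, h1⟩ := h
  unfold prof drop
  rw [hatInt_of_ge (by norm_num) (by linarith), hatInt_of_ge (by norm_num) (by linarith),
    hatInt_of_ge (by norm_num) h0, hatInt_of_mem ⟨h0, h1⟩]
  ring

lemma dprof_of_mem_two_three (ρ : ℝ) {t : ℝ} (h : t ∈ Set.Icc (2 : ℝ) 3) :
    dprof ρ t = 2 * (t - 5 / 2) := by
  obtain ⟨h0, h1⟩ := h
  unfold dprof
  rw [hat_of_ge (by norm_num) (by linarith), hat_of_ge (by norm_num) (by linarith),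
    hat_of_ge (by norm_num) h0, hat_of_mem ⟨h0, h1⟩]
  ring

/-- The quintic smoothstep, rising from `0` to `1` on `[1, 2]` and constant elsewhere. -/
def step (t : ℝ) : ℝ := 10 * hat 1 2 t ^ 3 - 15 * hat 1 2 t ^ 4 + 6 * hat 1 2 t ^ 5

/-- The derivative of `step`. -/
def dstep (t : ℝ) : ℝ := 30 * (hat 1 2 t * (1 - hat 1 2 t)) ^ 2

lemma step_of_le {t : ℝ} (h : t ≤ 1) : step t = 0 := by
  rw [step, hat_of_le (by norm_num) h]
  ring

lemma step_of_ge {t : ℝ} (h : 2 ≤ t) : step t = 1 := by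
  rw [step, hat_of_ge (by norm_num) h]
  ring

lemma dstep_of_le {t : ℝ} (h : t ≤ 1) : dstep t = 0 := by
  rw [dstep, hat_of_le (by norm_num) h]
  ring

lemma dstep_of_ge {t : ℝ} (h : 2 ≤ t) : dstep t = 0 := by
  rw [dstep, hat_of_ge (by norm_num) h]
  ring

lemma dstep_nonneg (t : ℝ) : 0 ≤ dstep t := by unfold dstep; positivity

lemma dstep_le_two (t : ℝ) : dstep t ≤ 2 := by
  have h0 := hat_nonneg (by norm_num : (1 : ℝ) ≤ 2) t
  have h1 := hat_le (by norm_num : (1 : ℝ) ≤ 2) t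
  have h2 : hat 1 2 t * (1 - hat 1 2 t) ≤ 1 / 4 := by nlinarith [sq_nonneg (hat 1 2 t - 1 / 2)]
  have h3 : 0 ≤ hat 1 2 t * (1 - hat 1 2 t) := mul_nonneg h0 (by linarith)
  unfold dstep
  nlinarith

lemma step_nonneg (t : ℝ) : 0 ≤ step t := by
  have h0 := hat_nonneg (by norm_num : (1 : ℝ) ≤ 2) t
  have h : step t = hat 1 2 t ^ 3 * (6 * (hat 1 2 t - 5 / 4) ^ 2 + 5 / 8) := by
    unfold step; ring
  rw [h]
  positivity

lemma step_le_one (t : ℝ) : step t ≤ 1 := by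
  have h1 : 0 ≤ 1 - hat 1 2 t := by linarith [hat_le (by norm_num : (1 : ℝ) ≤ 2) t]
  have h : 1 - step t = (1 - hat 1 2 t) ^ 3 * (6 * (hat 1 2 t + 1 / 4) ^ 2 + 5 / 8) := by
    unfold step; ring
  have : 0 ≤ 1 - step t := by rw [h]; positivity
  linarith

lemma hasDerivAt_step (t : ℝ) : HasDerivAt step (dstep t) t := by
  have key : ∀ s : Set ℝ, IsClosed s → (∀ y ∈ s, hat 1 2 y = y - 1) ∨
      (∀ y ∈ s, hat 1 2 y = 0) ∨ (∀ y ∈ s, hat 1 2 y = 1) →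
      HasDerivWithinAt step (dstep t) s t := by
    intro s hs h
    by_cases ht : t ∈ s
    · rcases h with h | h | h
      · have hp : HasDerivAt (fun y : ℝ => 10 * (y - 1) ^ 3 - 15 * (y - 1) ^ 4 + 6 * (y - 1) ^ 5)
            (dstep t) t := by
          have hy := (hasDerivAt_id t).sub_const (1 : ℝ)
          refine ((((hy.pow 3).const_mul 10).sub ((hy.pow 4).const_mul 15)).add
            ((hy.pow 5).const_mul 6)).congr_deriv ?_
          rw [dstep, h t ht]
          simp only [id]
          push_cast
          ring
        exact hp.hasDerivWithinAt.congr (fun y hy => by rw [step, h y hy])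
          (by rw [step, h t ht])
      · exact ((hasDerivWithinAt_const t s (0 : ℝ)).congr
          (fun y hy => by rw [step, h y hy]; ring)
          (by rw [step, h t ht]; ring)).congr_deriv (by rw [dstep, h t ht]; ring)
      · exact ((hasDerivWithinAt_const t s (1 : ℝ)).congr
          (fun y hy => by rw [step, h y hy]; ring)
          (by rw [step, h t ht]; ring)).congr_deriv (by rw [dstep, h t ht]; ring)
    · exact HasFDerivWithinAt.of_notMem_closure (by rwa [hs.closure_eq])
  have h1 := key (Set.Iic 1) isClosed_Iic (.inr (.inl fun y hy => hat_of_le (by norm_num) hy))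
  have h2 := key (Set.Icc 1 2) isClosed_Icc (.inl fun y hy => hat_of_mem hy)
  have h3 := key (Set.Ici 2) isClosed_Ici
    (.inr (.inr fun y hy => (hat_of_ge (by norm_num) hy).trans (by norm_num)))
  have h := (h1.union h2).union h3
  rw [Set.Iic_union_Icc_eq_Iic (by norm_num), Set.Iic_union_Ici] at h
  exact hasDerivWithinAt_univ.1 h

/-- The correction that turns the parabola `prof ρ (t + 2) + drop ρ` into `prof ρ t`. -/
def corr (ρ t : ℝ) : ℝ := prof ρ t - prof ρ (t + 2) - drop ρ

/-- The derivative of `corr`. -/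
def dcorr (ρ t : ℝ) : ℝ := dprof ρ t - dprof ρ (t + 2)

lemma hasDerivAt_corr (ρ t : ℝ) : HasDerivAt (corr ρ) (dcorr ρ t) t :=
  ((hasDerivAt_prof ρ t).sub ((hasDerivAt_prof ρ (t + 2)).comp_add_const t 2)).sub_const _

lemma corr_of_mem (ρ : ℝ) {t : ℝ} (h : t ∈ Set.Icc (0 : ℝ) 1) :
    corr ρ t = (curv ρ t - 1) * (t - 1 / 2) ^ 2 := by
  rw [corr, prof_of_mem_zero_one ρ h,
    prof_of_mem_two_three ρ ⟨by linarith [h.1], by linarith [h.2]⟩]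
  ring

lemma dcorr_of_mem (ρ : ℝ) {t : ℝ} (h : t ∈ Set.Icc (0 : ℝ) 1) :
    dcorr ρ t = 2 * (curv ρ t - 1) * (t - 1 / 2) := by
  rw [dcorr, dprof_of_mem_zero_one ρ h,
    dprof_of_mem_two_three ρ ⟨by linarith [h.1], by linarith [h.2]⟩]
  ring

/-- A function on the line that is bounded and Lipschitz. -/
def BddLip (a : ℝ → ℝ) : Prop := ∃ M, ∀ s t, |a t| ≤ M ∧ |a s - a t| ≤ M * |s - t|

lemma BddLip.add {a b : ℝ → ℝ} (ha : BddLip a) (hb : BddLip b) : BddLip fun t => a t + b t := by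
  obtain ⟨M, ha⟩ := ha
  obtain ⟨N, hb⟩ := hb
  refine ⟨M + N, fun s t => ⟨?_, ?_⟩⟩
  · exact (abs_add_le _ _).trans (add_le_add (ha s t).1 (hb s t).1)
  · rw [add_sub_add_comm, add_mul]
    exact (abs_add_le _ _).trans (add_le_add (ha s t).2 (hb s t).2)

lemma BddLip.const_mul {a : ℝ → ℝ} (ha : BddLip a) (c : ℝ) : BddLip fun t => c * a t := by
  obtain ⟨M, ha⟩ := ha
  refine ⟨|c| * M, fun s t => ⟨?_, ?_⟩⟩
  · rw [abs_mul]
    exact mul_le_mul_of_nonneg_left (ha s t).1 (abs_nonneg c)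
  · rw [← mul_sub, abs_mul, mul_assoc]
    exact mul_le_mul_of_nonneg_left (ha s t).2 (abs_nonneg c)

lemma bddLip_const (c : ℝ) : BddLip fun _ => c :=
  ⟨|c|, fun s t => ⟨le_rfl, by rw [sub_self, abs_zero]; positivity⟩⟩

lemma BddLip.mul {a b : ℝ → ℝ} (ha : BddLip a) (hb : BddLip b) : BddLip fun t => a t * b t := by
  obtain ⟨M, ha⟩ := ha
  obtain ⟨N, hb⟩ := hb
  have hM : 0 ≤ M := (abs_nonneg _).trans (ha 0 0).1
  have hN : 0 ≤ N := (abs_nonneg _).trans (hb 0 0).1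
  refine ⟨M * N + M * N, fun s t => ⟨?_, ?_⟩⟩
  · rw [abs_mul]
    have := mul_le_mul (ha s t).1 (hb s t).1 (abs_nonneg _) hM
    nlinarith [mul_nonneg hM hN]
  · have h : a s * b s - a t * b t = a s * (b s - b t) + (a s - a t) * b t := by ring
    have h1 := mul_le_mul (ha t s).1 (hb s t).2 (abs_nonneg _) hM
    have h2 := mul_le_mul (ha s t).2 (hb s t).1 (abs_nonneg _) (by positivity)
    rw [h]
    refine (abs_add_le _ _).trans ?_
    rw [abs_mul, abs_mul]
    nlinarith

lemma BddLip.comp_add_const {a : ℝ → ℝ} (ha : BddLip a) (c : ℝ) : BddLip fun t => a (t + c) := by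
  obtain ⟨M, ha⟩ := ha
  exact ⟨M, fun s t => ⟨(ha (s + c) (t + c)).1, by simpa using (ha (s + c) (t + c)).2⟩⟩

lemma bddLip_hat {a b : ℝ} (h : a ≤ b) : BddLip (hat a b) := by
  refine ⟨b - a + 1, fun s t => ⟨?_, ?_⟩⟩
  · rw [abs_of_nonneg (hat_nonneg h t)]
    linarith [hat_le h t]
  · nlinarith [abs_hat_sub_le h s t, abs_nonneg (s - t)]

lemma bddLip_dprof (ρ : ℝ) : BddLip (dprof ρ) := by
  have h := ((((bddLip_const (-4)).add
    ((bddLip_hat (by norm_num : (0 : ℝ) ≤ 1 / 2)).const_mul 8)).add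
    ((bddLip_hat (by norm_num : (1 / 2 : ℝ) ≤ 1)).const_mul (-(2 * ρ)))).add
    ((bddLip_hat (by norm_num : (1 : ℝ) ≤ 2)).const_mul (-(1 - ρ)))).add
    ((bddLip_hat (by norm_num : (2 : ℝ) ≤ 3)).const_mul 2)
  convert h using 2
  unfold dprof
  ring

lemma bddLip_dcorr (ρ : ℝ) : BddLip (dcorr ρ) := by
  have h := (bddLip_dprof ρ).add (((bddLip_dprof ρ).comp_add_const 2).const_mul (-1))
  convert h using 2
  unfold dcorr
  ring

lemma bddLip_dstep : BddLip dstep := by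
  have h0 := bddLip_hat (by norm_num : (1 : ℝ) ≤ 2)
  have h1 := h0.mul ((bddLip_const 1).add (h0.const_mul (-1)))
  have h := (h1.mul h1).const_mul 30
  convert h using 2
  unfold dstep
  ring

lemma bddLip_step : BddLip step := by
  have h0 := bddLip_hat (by norm_num : (1 : ℝ) ≤ 2)
  have h2 := h0.mul h0
  have h3 := h2.mul h0
  have h := ((h3.const_mul 10).add ((h2.mul h2).const_mul (-15))).add ((h3.mul h2).const_mul 6)
  convert h using 2
  unfold step
  ring

/-- A function with bounded derivative is Lipschitz. -/
lemma abs_sub_le_of_hasDerivAt {a a' : ℝ → ℝ} {M : ℝ} (h : ∀ t, HasDerivAt a (a' t) t)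
    (hM : ∀ t, |a' t| ≤ M) (s t : ℝ) : |a s - a t| ≤ M * |s - t| :=
  Convex.norm_image_sub_le_of_norm_hasDerivWithin_le (s := Set.univ)
    (fun x _ => (h x).hasDerivWithinAt) (fun x _ => hM x) convex_univ (Set.mem_univ t)
    (Set.mem_univ s)

/-- Both parts of `corr` have bounded derivatives, and they differ by the translation by `2`. -/
lemma bddLip_corr (ρ : ℝ) : BddLip (corr ρ) := by
  obtain ⟨M, hM⟩ := bddLip_dprof ρ
  obtain ⟨N, hN⟩ := bddLip_dcorr ρ
  have hM0 : 0 ≤ M := (abs_nonneg _).trans (hM 0 0).1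
  have hN0 : 0 ≤ N := (abs_nonneg _).trans (hN 0 0).1
  refine ⟨M * 2 + |drop ρ| + N, fun s t => ⟨?_, ?_⟩⟩
  · have h := abs_sub_le_of_hasDerivAt (hasDerivAt_prof ρ) (fun t => (hM t t).1) t (t + 2)
    rw [show |t - (t + 2)| = 2 by norm_num] at h
    have := abs_sub (prof ρ t - prof ρ (t + 2)) (drop ρ)
    unfold corr
    linarith
  · refine (abs_sub_le_of_hasDerivAt (hasDerivAt_corr ρ) (fun t => (hN t t).1) s t).trans ?_
    exact mul_le_mul_of_nonneg_right (by linarith [abs_nonneg (drop ρ)]) (abs_nonneg _)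

/-! ### Coordinates along the staircase -/

/-- The direction in which the staircase is traversed in its `k`-th strip (numbered from `0`). -/
def par (k : ℕ) : Fin 2 := if Even k then 0 else 1

lemma par_two_mul (m : ℕ) : par (2 * m) = 0 := by simp [par]

lemma par_two_mul_add_one (m : ℕ) : par (2 * m + 1) = 1 := by simp [par]

lemma par_add_two (k : ℕ) : par (k + 2) = par k := by simp [par, Nat.even_add]

lemma par_succ_ne (k : ℕ) : par (k + 1) ≠ par k := by
  unfold par
  by_cases h : Even k <;> simp [h, Nat.even_add_one]

/-- The coordinate along the `k`-th strip, in units of `τ`, starting at its first block.  In block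
number `k + 1` both `crd τ k` and `crd τ (k + 1)` run through `[0, 1]`; in the buffer behind it
`crd τ k` runs through `[1, 2]`, and in the next block through `[2, 3]`. -/
def crd (τ : ℝ) (k : ℕ) (x : Plane) : ℝ := x (par k) / τ - 2 * ((k / 2 : ℕ) : ℝ)

lemma crd_add_two (τ : ℝ) (k : ℕ) (x : Plane) : crd τ (k + 2) x = crd τ k x - 2 := by
  rw [crd, crd, par_add_two, show (k + 2) / 2 = k / 2 + 1 by omega]
  push_cast
  ring

/-- Blocks `k + 1` and `k + 2`, and the buffer between them. -/
def strip (τ : ℝ) (k : ℕ) : Set Plane :=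
  {x | crd τ k x ∈ Set.Icc (0 : ℝ) 3 ∧ crd τ (k + 1) x ∈ Set.Icc (0 : ℝ) 1}

lemma crd_two_mul (hτ : 0 < τ) (m : ℕ) (x : Plane) :
    x 0 = τ * (crd τ (2 * m) x + 2 * m) := by
  rw [crd, par_two_mul, show 2 * m / 2 = m by omega]
  field_simp
  ring

lemma crd_two_mul_add_one (hτ : 0 < τ) (m : ℕ) (x : Plane) :
    x 1 = τ * (crd τ (2 * m + 1) x + 2 * m) := by
  rw [crd, par_two_mul_add_one, show (2 * m + 1) / 2 = m by omega]
  field_simp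
  ring

lemma crd_two_mul_add_two (hτ : 0 < τ) (m : ℕ) (x : Plane) :
    x 0 = τ * (crd τ (2 * m + 1 + 1) x + 2 * (m + 1)) := by
  rw [crd_two_mul hτ m x, show 2 * m + 1 + 1 = 2 * m + 2 by ring, crd_add_two]
  ring

lemma left_two_mul_add_one (τ : ℝ) (m : ℕ) : left τ (2 * m + 1) = τ * (2 * m) := by
  rw [left, show (2 * m + 1) / 2 = m by omega]; ring

lemma left_two_mul_add_two (τ : ℝ) (m : ℕ) : left τ (2 * m + 1 + 1) = τ * (2 * (m + 1)) := by
  rw [left, show (2 * m + 1 + 1) / 2 = m + 1 by omega]; push_cast; ring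

lemma bottom_two_mul_add_one (τ : ℝ) (m : ℕ) : bottom τ (2 * m + 1) = τ * (2 * m) := by
  rw [bottom, show (2 * m + 1 - 1) / 2 = m by omega]; ring

lemma bottom_two_mul_add_two (τ : ℝ) (m : ℕ) : bottom τ (2 * m + 1 + 1) = τ * (2 * m) := by
  rw [bottom, show (2 * m + 1 + 1 - 1) / 2 = m by omega]; ring

lemma mem_Icc_mul_iff (hτ : 0 < τ) (u a b c d e : ℝ) (hd : d = τ * (a + c)) (he : e = τ * (b + c)) :
    τ * (u + c) ∈ Set.Icc d e ↔ u ∈ Set.Icc a b := by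
  subst hd he
  rw [Set.mem_Icc, Set.mem_Icc, mul_le_mul_iff_right₀ hτ, mul_le_mul_iff_right₀ hτ,
    add_le_add_iff_right, add_le_add_iff_right]

lemma mem_block_iff (hτ : 0 < τ) (k : ℕ) (x : Plane) :
    x ∈ block τ (k + 1) ↔ crd τ k x ∈ Set.Icc (0 : ℝ) 1 ∧ crd τ (k + 1) x ∈ Set.Icc (0 : ℝ) 1 := by
  obtain ⟨m, rfl | rfl⟩ := Nat.even_or_odd' k
  · rw [block, Set.mem_ofPred_eq, left_two_mul_add_one,
      bottom_two_mul_add_one,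
      crd_two_mul hτ m x, crd_two_mul_add_one hτ m x, mem_Icc_mul_iff hτ _ 0 1,
      mem_Icc_mul_iff hτ _ 0 1] <;> ring
  · rw [block, Set.mem_ofPred_eq, left_two_mul_add_two, bottom_two_mul_add_two,
      crd_two_mul_add_two hτ m x, crd_two_mul_add_one hτ m x, mem_Icc_mul_iff hτ _ 0 1,
      mem_Icc_mul_iff hτ _ 0 1, and_comm] <;> ring

lemma mem_buffer_iff (hτ : 0 < τ) (k : ℕ) (x : Plane) :
    x ∈ buffer τ (k + 1) ↔ crd τ k x ∈ Set.Icc (1 : ℝ) 2 ∧ crd τ (k + 1) x ∈ Set.Icc (0 : ℝ) 1 := by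
  obtain ⟨m, rfl | rfl⟩ := Nat.even_or_odd' k
  · rw [buffer, if_pos (odd_two_mul_add_one m), Set.mem_ofPred_eq, left_two_mul_add_one,
      bottom_two_mul_add_one,
      crd_two_mul hτ m x, crd_two_mul_add_one hτ m x, mem_Icc_mul_iff hτ _ 1 2,
      mem_Icc_mul_iff hτ _ 0 1] <;> ring
  · rw [buffer, if_neg (by simp [Nat.even_add_one]), Set.mem_ofPred_eq, left_two_mul_add_two,
      bottom_two_mul_add_two,
      crd_two_mul_add_two hτ m x, crd_two_mul_add_one hτ m x, mem_Icc_mul_iff hτ _ 0 1,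
      mem_Icc_mul_iff hτ _ 1 2, and_comm] <;> ring

lemma mem_block_succ_iff (hτ : 0 < τ) (k : ℕ) (x : Plane) :
    x ∈ block τ (k + 2) ↔ crd τ k x ∈ Set.Icc (2 : ℝ) 3 ∧ crd τ (k + 1) x ∈ Set.Icc (0 : ℝ) 1 := by
  rw [mem_block_iff hτ (k + 1), crd_add_two, and_comm, Set.mem_Icc (a := 0) (b := 1),
    Set.mem_Icc (a := 2)]
  constructor <;> rintro ⟨⟨h1, h2⟩, h3⟩ <;> exact ⟨⟨by linarith, by linarith⟩, h3⟩

lemma mem_strip_iff (hτ : 0 < τ) (k : ℕ) (x : Plane) :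
    x ∈ strip τ k ↔ x ∈ block τ (k + 1) ∨ x ∈ buffer τ (k + 1) ∨ x ∈ block τ (k + 2) := by
  rw [mem_block_iff hτ, mem_buffer_iff hτ, mem_block_succ_iff hτ, strip, Set.mem_ofPred_eq,
    ← or_and_right, ← or_and_right]
  refine and_congr_left fun _ => ⟨fun h => ?_, ?_⟩
  · rcases le_total (crd τ k x) 1 with h1 | h1
    · exact .inl ⟨h.1, h1⟩
    · rcases le_total (crd τ k x) 2 with h2 | h2
      · exact .inr (.inl ⟨h1, h2⟩)
      · exact .inr (.inr ⟨h2, h.2⟩)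
  · rintro (h | h | h) <;> exact ⟨by linarith [h.1], by linarith [h.2]⟩

/-- The region is the union of the strips. -/
lemma mem_region_iff (hτ : 0 < τ) {n : ℕ} (hn : 2 ≤ n) (x : Plane) :
    x ∈ region τ n ↔ ∃ k, k + 2 ≤ n ∧ x ∈ strip τ k := by
  constructor
  · rintro (⟨i, h1, h2, h⟩ | ⟨i, h1, h2, h⟩)
    · obtain ⟨k, rfl⟩ : ∃ k, i = k + 1 := ⟨i - 1, by omega⟩
      by_cases hk : k = 0
      · subst hk
        exact ⟨0, hn, (mem_strip_iff hτ 0 x).2 (.inl h)⟩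
      · obtain ⟨j, rfl⟩ : ∃ j, k = j + 1 := ⟨k - 1, by omega⟩
        exact ⟨j, h2, (mem_strip_iff hτ j x).2 (.inr (.inr h))⟩
    · obtain ⟨k, rfl⟩ : ∃ k, i = k + 1 := ⟨i - 1, by omega⟩
      exact ⟨k, h2, (mem_strip_iff hτ k x).2 (.inr (.inl h))⟩
  · rintro ⟨k, hk, h⟩
    rcases (mem_strip_iff hτ k x).1 h with h | h | h
    · exact .inl ⟨k + 1, by omega, by omega, h⟩
    · exact .inr ⟨k + 1, by omega, by omega, h⟩
    · exact .inl ⟨k + 2, by omega, by omega, h⟩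

lemma crd_center (hτ : 0 < τ) (k : ℕ) :
    crd τ k (center τ (k + 1)) = 1 / 2 ∧ crd τ (k + 1) (center τ (k + 1)) = 1 / 2 := by
  set x := center τ (k + 1) with hx
  obtain ⟨m, rfl | rfl⟩ := Nat.even_or_odd' k
  · have h0 := crd_two_mul hτ m x
    have h1 := crd_two_mul_add_one hτ m x
    rw [hx] at h0 h1
    simp only [center, s₁, s₂, left_two_mul_add_one, bottom_two_mul_add_one,
      PiLp.toLp_apply, Matrix.cons_val_zero, Matrix.cons_val_one] at h0 h1
    constructor <;> apply mul_left_cancel₀ hτ.ne' <;> simp only [hx, center, s₁, s₂,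
      left_two_mul_add_one, bottom_two_mul_add_one] <;> linarith
  · have h0 := crd_two_mul_add_two hτ m x
    have h1 := crd_two_mul_add_one hτ m x
    rw [hx] at h0 h1
    simp only [center, s₁, s₂, left_two_mul_add_two, bottom_two_mul_add_two,
      PiLp.toLp_apply, Matrix.cons_val_zero, Matrix.cons_val_one] at h0 h1
    constructor <;> apply mul_left_cancel₀ hτ.ne' <;> simp only [hx, center, s₁, s₂,
      left_two_mul_add_two, bottom_two_mul_add_two] <;> linarith

lemma eq_of_crd_eq (hτ : 0 < τ) (k : ℕ) {x y : Plane} (h : crd τ k x = crd τ k y)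
    (h' : crd τ (k + 1) x = crd τ (k + 1) y) : x = y := by
  have e : ∀ j, crd τ j x = crd τ j y → x (par j) = y (par j) := by
    intro j hj
    unfold crd at hj
    field_simp at hj
    linarith
  ext i
  have h1 := e k h
  have h2 := e (k + 1) h'
  obtain ⟨m, rfl | rfl⟩ := Nat.even_or_odd' k
  · rw [par_two_mul] at h1
    rw [par_two_mul_add_one] at h2
    fin_cases i <;> assumption
  · rw [par_two_mul_add_one] at h1
    rw [show 2 * m + 1 + 1 = 2 * (m + 1) by ring, par_two_mul] at h2
    fin_cases i <;> assumption

/-! ### The objective in staircase coordinates -/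

/-- The objective on the `k`-th strip, in terms of the coordinates `u` along and `v` across it:
up to scaling and a constant it is `prof u + prof (v + 2)` plus the term that lets the curvature
in the direction of `v` change inside the buffer, which is absent before the final block. -/
def stripFun (ρ L τ : ℝ) (n k : ℕ) (x : Plane) : ℝ :=
  L * τ ^ 2 * (prof ρ (crd τ k x) + prof ρ (crd τ (k + 1) x + 2)
    + (if k + 2 = n then 0 else 1) * (step (crd τ k x) * corr ρ (crd τ (k + 1) x)) - k * drop ρ)

lemma ν_eq (hL : 0 < L) : ν γ L τ = L * τ ^ 2 * drop (γ / L) := by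
  unfold ν g₁ p drop
  field_simp
  ring

lemma ite_curv (hτ : 0 < τ) (hL : 0 < L) (u c s x : ℝ) (hs : s = τ * (1 / 2 + c))
    (hx : x = τ * (u + c)) :
    (if s < x then -γ else 4 * L) * (x - s) ^ 2
      = L * τ ^ 2 * (curv (γ / L) u * (u - 1 / 2) ^ 2) := by
  subst hs hx
  have e : τ * (1 / 2 + c) < τ * (u + c) ↔ ¬ u ≤ 1 / 2 := by
    rw [mul_lt_mul_iff_right₀ hτ, add_lt_add_iff_right, not_le]
  unfold curv
  by_cases h : u ≤ 1 / 2
  · rw [if_neg (by rwa [e, not_not]), if_pos h]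
    ring
  · rw [if_pos (e.2 h), if_neg h]
    field_simp
    ring

lemma blockFun_eq (hτ : 0 < τ) (hL : 0 < L) (n k : ℕ) (x : Plane) :
    blockFun γ L τ n (k + 1) x = L * τ ^ 2 *
      ((if k + 1 = n then 1 else curv (γ / L) (crd τ k x)) * (crd τ k x - 1 / 2) ^ 2
        + (crd τ (k + 1) x - 1 / 2) ^ 2 - (k + 1) * drop (γ / L)) := by
  rw [blockFun, ν_eq hL]
  obtain ⟨m, rfl | rfl⟩ := Nat.even_or_odd' k
  · have h0 := crd_two_mul hτ m x
    have h1 := crd_two_mul_add_one hτ m x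
    have e1 : s₁ τ (2 * m + 1) = τ * (1 / 2 + 2 * m) := by rw [s₁, left_two_mul_add_one]; ring
    have e2 : s₂ τ (2 * m + 1) = τ * (1 / 2 + 2 * m) := by rw [s₂, bottom_two_mul_add_one]; ring
    rw [if_pos (odd_two_mul_add_one m), ite_curv hτ hL _ _ _ _ e1 h0]
    split_ifs
    · rw [h0, h1, e1, e2]; push_cast; ring
    · rw [h1, e2]; push_cast; ring
  · have h0 := crd_two_mul_add_two hτ m x
    have h1 := crd_two_mul_add_one hτ m x
    have e1 : s₁ τ (2 * m + 1 + 1) = τ * (1 / 2 + 2 * (m + 1)) := by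
      rw [s₁, left_two_mul_add_two]; ring
    have e2 : s₂ τ (2 * m + 1 + 1) = τ * (1 / 2 + 2 * m) := by rw [s₂, bottom_two_mul_add_two]; ring
    rw [if_neg (by simp [Nat.even_add_one] : ¬ Odd (2 * m + 1 + 1)), ite_curv hτ hL _ _ _ _ e2 h1]
    split_ifs
    · rw [h0, h1, e1, e2]; push_cast; ring
    · rw [h0, e1]; push_cast; ring

lemma g_eq (hτ : 0 < τ) (hL : 0 < L) (q : Prop) {u v a b : ℝ} (hu : u ∈ Set.Icc (1 : ℝ) 2)
    (ha : a = τ * u) (hb : b = τ * (v - 1 / 2)) [Decidable q] :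
    g γ L τ q a b = L * τ ^ 2 * (prof (γ / L) u
      + (1 + (if q then 0 else 1) * (step u * (curv (γ / L) v - 1))) * (v - 1 / 2) ^ 2) := by
  subst ha hb
  rw [prof_of_mem_one_two _ hu, step, hat_of_mem hu, g]
  have e : g₁ γ L τ (τ * u)
      = L * τ ^ 2 * (-(γ / L) / 4 - γ / L * (u - 1) - (1 - γ / L) / 2 * (u - 1) ^ 2) := by
    unfold g₁ p
    field_simp
    ring
  have e2 : ∀ c, g₂ τ L c (τ * u)
      = L + (10 * (u - 1) ^ 3 - 15 * (u - 1) ^ 4 + 6 * (u - 1) ^ 5) * (c - L) := by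
    intro c
    unfold g₂
    field_simp
    ring
  rw [e, e2]
  have e3 : (if τ * (v - 1 / 2) < 0 then 4 * L else -γ) * (v - 1 / 2) ^ 2
      = L * curv (γ / L) v * (v - 1 / 2) ^ 2 := by
    rcases lt_trichotomy v (1 / 2) with h | h | h
    · rw [curv, if_pos h.le, if_pos (mul_neg_of_pos_of_neg hτ (by linarith))]
      ring
    -- on the center line the two conventions for the curvature differ, but its factor vanishes
    · rw [h]; ring
    · rw [curv, if_neg (not_le.2 h), if_neg (not_lt.2 (mul_nonneg hτ.le (by linarith)))]
      field_simp
  by_cases hq : q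
  · simp only [hq, if_true]
    ring
  · simp only [hq, if_false]
    linear_combination (τ ^ 2 * (10 * (u - 1) ^ 3 - 15 * (u - 1) ^ 4 + 6 * (u - 1) ^ 5)) * e3

lemma bufferFun_eq (hτ : 0 < τ) (hL : 0 < L) (n k : ℕ) (x : Plane)
    (hu : crd τ k x ∈ Set.Icc (1 : ℝ) 2) :
    bufferFun γ L τ n (k + 1) x = L * τ ^ 2 * (prof (γ / L) (crd τ k x)
      + (1 + (if k + 2 = n then 0 else 1) * (step (crd τ k x) *
        (curv (γ / L) (crd τ (k + 1) x) - 1))) * (crd τ (k + 1) x - 1 / 2) ^ 2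
        - (k + 1) * drop (γ / L)) := by
  rw [bufferFun, ν_eq hL]
  obtain ⟨m, rfl | rfl⟩ := Nat.even_or_odd' k
  · rw [if_pos (odd_two_mul_add_one m), g_eq hτ hL (2 * m + 1 + 1 = n) hu
      (v := crd τ (2 * m + 1) x)]
    · push_cast; ring
    · rw [crd_two_mul hτ m x, left_two_mul_add_one]; ring
    · rw [crd_two_mul_add_one hτ m x, s₂, bottom_two_mul_add_one]; ring
  · rw [if_neg (by simp [Nat.even_add_one] : ¬ Odd (2 * m + 1 + 1)),
      g_eq hτ hL (2 * m + 1 + 1 + 1 = n) hu (v := crd τ (2 * m + 1 + 1) x)]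
    · push_cast; ring
    · rw [crd_two_mul_add_one hτ m x, bottom_two_mul_add_two]; ring
    · rw [crd_two_mul_add_two hτ m x, s₁, left_two_mul_add_two]; ring

lemma prof_add_two (ρ : ℝ) {v : ℝ} (hv : v ∈ Set.Icc (0 : ℝ) 1) :
    prof ρ (v + 2) = (v - 1 / 2) ^ 2 - drop ρ := by
  rw [prof_of_mem_two_three ρ ⟨by linarith [hv.1], by linarith [hv.2]⟩]
  ring

lemma stripFun_eq_blockFun (hτ : 0 < τ) (hL : 0 < L) {n k : ℕ} (hk : k + 2 ≤ n) {x : Plane}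
    (hx : x ∈ block τ (k + 1)) : stripFun (γ / L) L τ n k x = blockFun γ L τ n (k + 1) x := by
  obtain ⟨hu, hv⟩ := (mem_block_iff hτ k x).1 hx
  rw [blockFun_eq hτ hL, stripFun, if_neg (by omega : k + 1 ≠ n), step_of_le hu.2,
    prof_of_mem_zero_one _ hu, prof_add_two _ hv]
  ring

lemma stripFun_eq_bufferFun (hτ : 0 < τ) (hL : 0 < L) {n k : ℕ} {x : Plane}
    (hx : x ∈ buffer τ (k + 1)) : stripFun (γ / L) L τ n k x = bufferFun γ L τ n (k + 1) x := by
  obtain ⟨hu, hv⟩ := (mem_buffer_iff hτ k x).1 hx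
  rw [bufferFun_eq hτ hL _ _ _ hu, stripFun, prof_add_two _ hv, corr_of_mem _ hv]
  ring

lemma stripFun_eq_blockFun_succ (hτ : 0 < τ) (hL : 0 < L) {n k : ℕ} {x : Plane}
    (hx : x ∈ block τ (k + 2)) : stripFun (γ / L) L τ n k x = blockFun γ L τ n (k + 2) x := by
  obtain ⟨hu, hv⟩ := (mem_block_succ_iff hτ k x).1 hx
  rw [blockFun_eq hτ hL, stripFun, crd_add_two, step_of_ge hu.1,
    prof_of_mem_two_three _ hu, prof_add_two _ hv, corr_of_mem _ hv]
  split_ifs <;> push_cast <;> ring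

lemma IsObjective.eq_stripFun {n : ℕ} {f : Plane → ℝ} (hf : IsObjective γ L τ n f) (hτ : 0 < τ)
    (hL : 0 < L) {k : ℕ} (hk : k + 2 ≤ n) {x : Plane} (hx : x ∈ strip τ k) :
    f x = stripFun (γ / L) L τ n k x := by
  rcases (mem_strip_iff hτ k x).1 hx with h | h | h
  · rw [hf.eq_on_block _ (by omega) (by omega) x h, stripFun_eq_blockFun hτ hL hk h]
  · rw [hf.eq_on_buffer _ (by omega) (by omega) x h, stripFun_eq_bufferFun hτ hL h]
  · rw [hf.eq_on_block _ (by omega) (by omega) x h, stripFun_eq_blockFun_succ hτ hL h]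

/-! ### Gradients -/

lemma hasGradientAt_add {f h : Plane → ℝ} {F H x : Plane} (hf : HasGradientAt f F x)
    (hh : HasGradientAt h H x) : HasGradientAt (fun y => f y + h y) (F + H) x := by
  rw [hasGradientAt_iff_hasFDerivAt] at *
  rw [map_add]
  exact hf.add hh

lemma hasGradientAt_mul {f h : Plane → ℝ} {F H x : Plane} (hf : HasGradientAt f F x)
    (hh : HasGradientAt h H x) :
    HasGradientAt (fun y => f y * h y) (f x • H + h x • F) x := by
  rw [hasGradientAt_iff_hasFDerivAt] at *
  rw [map_add, map_smulₛₗ, map_smulₛₗ]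
  exact hf.mul hh

lemma hasGradientAt_const_mul {f : Plane → ℝ} {F x : Plane} (c : ℝ) (hf : HasGradientAt f F x) :
    HasGradientAt (fun y => c * f y) (c • F) x := by
  simpa using hasGradientAt_mul (hasGradientAt_const x c) hf

/-- The unit vector along the `k`-th strip. -/
def dir (k : ℕ) : Plane := EuclideanSpace.single (par k) 1

lemma norm_dir (k : ℕ) : ‖dir k‖ = 1 := by simp [dir]

lemma hasGradientAt_crd {a : ℝ → ℝ} {a' : ℝ} {k : ℕ} {x : Plane}
    (h : HasDerivAt a a' (crd τ k x)) :
    HasGradientAt (fun y => a (crd τ k y)) ((a' / τ) • dir k) x := by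
  have h1 : HasFDerivAt (fun y : Plane => crd τ k y)
      (τ⁻¹ • (EuclideanSpace.proj (par k) : Plane →L[ℝ] ℝ)) x := by
    have h2 := (((EuclideanSpace.proj (par k) : Plane →L[ℝ] ℝ).hasFDerivAt (x := x)).const_mul
      τ⁻¹).sub_const (2 * ((k / 2 : ℕ) : ℝ))
    refine h2.congr_of_eventuallyEq (Filter.Eventually.of_forall fun y => ?_)
    simp only [crd, PiLp.proj_apply]
    ring
  rw [hasGradientAt_iff_hasFDerivAt]
  refine (h.comp_hasFDerivAt x h1).congr_fderiv ?_
  ext y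
  simp only [dir, map_smulₛₗ, _root_.smul_apply, PiLp.proj_apply,
    InnerProductSpace.toDual_apply_apply, EuclideanSpace.inner_single_left, smul_eq_mul]
  simp
  ring

lemma crd_smul_dir (τ s : ℝ) (k : ℕ) (x : Plane) (hτ : 0 < τ) (a b : ℝ) :
    crd τ k (x - (τ * s) • (a • dir k + b • dir (k + 1))) = crd τ k x - s * a ∧
    crd τ (k + 1) (x - (τ * s) • (a • dir k + b • dir (k + 1))) = crd τ (k + 1) x - s * b := by
  have h := par_succ_ne k
  constructor
  · simp [crd, dir, h.symm]
    field_simp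
    ring
  · simp [crd, dir, h]
    field_simp
    ring

/-- The derivative of the objective along a strip, in units of `L * τ`, at the point with
coordinates `u` along and `v` across it; `ε` is `0` for the last strip and `1` otherwise. -/
def slope (ρ ε u v : ℝ) : ℝ := dprof ρ u + ε * (dstep u * corr ρ v)

/-- The derivative of the objective across a strip, with the conventions of `slope`. -/
def crossSlope (ρ ε u v : ℝ) : ℝ := dprof ρ (v + 2) + ε * (step u * dcorr ρ v)

lemma hasGradientAt_stripFun (hτ : 0 < τ) (ρ : ℝ) (n k : ℕ) (x : Plane) :
    HasGradientAt (stripFun ρ L τ n k)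
      ((L * τ) • (slope ρ (if k + 2 = n then 0 else 1) (crd τ k x) (crd τ (k + 1) x) • dir k +
        crossSlope ρ (if k + 2 = n then 0 else 1) (crd τ k x) (crd τ (k + 1) x)
          • dir (k + 1))) x := by
  have h1 := hasGradientAt_crd (τ := τ) (hasDerivAt_prof ρ (crd τ k x))
  have h2 := hasGradientAt_crd (τ := τ) (k := k + 1) (x := x)
    ((hasDerivAt_prof ρ (crd τ (k + 1) x + 2)).comp_add_const _ 2)
  have h3 := hasGradientAt_mul (hasGradientAt_crd (τ := τ) (hasDerivAt_step (crd τ k x)))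
    (hasGradientAt_crd (τ := τ) (hasDerivAt_corr ρ (crd τ (k + 1) x)))
  have h := hasGradientAt_const_mul (L * τ ^ 2) (hasGradientAt_add (hasGradientAt_add
    (hasGradientAt_add h1 h2) (hasGradientAt_const_mul (if k + 2 = n then 0 else 1) h3))
    (hasGradientAt_const x (-(k * drop ρ))))
  have e : stripFun ρ L τ n k = fun y => L * τ ^ 2 * (prof ρ (crd τ k y)
      + prof ρ (crd τ (k + 1) y + 2)
      + (if k + 2 = n then 0 else 1) * (step (crd τ k y) * corr ρ (crd τ (k + 1) y))
      + -(k * drop ρ)) := by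
    funext y
    rw [stripFun]
    ring
  rw [e]
  convert h using 1
  unfold slope crossSlope
  match_scalars <;> field_simp

lemma continuous_crd (τ : ℝ) (k : ℕ) : Continuous (crd τ k) := by
  unfold crd
  fun_prop

lemma convex_strip (τ : ℝ) (k : ℕ) : Convex ℝ (strip τ k) := by
  have key : ∀ j a b, Convex ℝ {x : Plane | crd τ j x ∈ Set.Icc a b} := by
    intro j a b x hx y hy s t hs ht hst
    have e : crd τ j (s • x + t • y) = s • crd τ j x + t • crd τ j y := by
      simp only [crd, PiLp.add_apply, PiLp.smul_apply, smul_eq_mul]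
      linear_combination (2 * ((j / 2 : ℕ) : ℝ)) * hst
    show crd τ j (s • x + t • y) ∈ Set.Icc a b
    rw [e]
    exact convex_Icc a b hx hy hs ht hst
  exact (key k 0 3).inter (key (k + 1) 0 1)

lemma uniqueDiffOn_strip (hτ : 0 < τ) (k : ℕ) : UniqueDiffOn ℝ (strip τ k) := by
  refine uniqueDiffOn_convex (convex_strip τ k) ⟨center τ (k + 1), ?_⟩
  obtain ⟨h1, h2⟩ := crd_center hτ k
  refine mem_interior_iff_mem_nhds.2 ?_
  filter_upwards [(continuous_crd τ k).continuousAt.preimage_mem_nhds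
    (Icc_mem_nhds (by rw [h1]; norm_num : (0 : ℝ) < _) (by rw [h1]; norm_num : _ < (3 : ℝ))),
    (continuous_crd τ (k + 1)).continuousAt.preimage_mem_nhds
    (Icc_mem_nhds (by rw [h2]; norm_num : (0 : ℝ) < _) (by rw [h2]; norm_num : _ < (1 : ℝ)))]
    with x hx hx'
  exact ⟨hx, hx'⟩

/-- The gradient of an objective on a strip, boundary included, is determined by its values
there, since the strip is convex with nonempty interior. -/
lemma IsObjective.gradient_eq {n : ℕ} {f : Plane → ℝ} (hf : IsObjective γ L τ n f) (hτ : 0 < τ)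
    (hL : 0 < L) {k : ℕ} (hk : k + 2 ≤ n) {x : Plane} (hx : x ∈ strip τ k) :
    gradient f x = (L * τ) •
      (slope (γ / L) (if k + 2 = n then 0 else 1) (crd τ k x) (crd τ (k + 1) x) • dir k +
      crossSlope (γ / L) (if k + 2 = n then 0 else 1) (crd τ k x) (crd τ (k + 1) x)
        • dir (k + 1)) := by
  have h1 := (hf.differentiable x).hasGradientAt.hasFDerivAt.hasFDerivWithinAt (s := strip τ k)
  have h2 := (hasGradientAt_stripFun (L := L) hτ (γ / L) n k x).hasFDerivAt.hasFDerivWithinAt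
    (s := strip τ k)
  have h3 := h2.congr (fun y hy => hf.eq_stripFun hτ hL hk hy) (hf.eq_stripFun hτ hL hk hx)
  exact (InnerProductSpace.toDual ℝ Plane).injective ((uniqueDiffOn_strip hτ k x hx).eq h1 h3)

/-! ### Existence of the extension -/

/-- The function has a Lipschitz gradient. -/
def LipGrad (f : Plane → ℝ) : Prop :=
  ∃ (G : Plane → Plane) (M : ℝ), ∀ x y, HasGradientAt f (G x) x ∧ ‖G x - G y‖ ≤ M * ‖x - y‖

lemma LipGrad.add {f h : Plane → ℝ} (hf : LipGrad f) (hh : LipGrad h) :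
    LipGrad fun x => f x + h x := by
  obtain ⟨F, M, hF⟩ := hf
  obtain ⟨H, N, hH⟩ := hh
  refine ⟨fun x => F x + H x, M + N, fun x y =>
    ⟨hasGradientAt_add (hF x x).1 (hH x x).1, ?_⟩⟩
  rw [add_sub_add_comm, add_mul]
  exact (norm_add_le _ _).trans (add_le_add (hF x y).2 (hH x y).2)

lemma LipGrad.const_mul {f : Plane → ℝ} (hf : LipGrad f) (c : ℝ) : LipGrad fun x => c * f x := by
  obtain ⟨F, M, hF⟩ := hf
  refine ⟨fun x => c • F x, |c| * M, fun x y => ⟨hasGradientAt_const_mul c (hF x x).1, ?_⟩⟩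
  rw [← smul_sub, norm_smul, Real.norm_eq_abs, mul_assoc]
  exact mul_le_mul_of_nonneg_left (hF x y).2 (abs_nonneg c)

lemma lipGrad_sum {ι : Type*} (s : Finset ι) (f : ι → Plane → ℝ) (h : ∀ i ∈ s, LipGrad (f i)) :
    LipGrad fun x => ∑ i ∈ s, f i x := by
  classical
  induction s using Finset.induction_on with
  | empty =>
    simp only [Finset.sum_empty]
    exact ⟨fun _ => 0, 0, fun x y => ⟨hasGradientAt_const x 0, by simp⟩⟩
  | insert a s ha ih =>
    simp only [Finset.sum_insert ha]
    exact (h a (Finset.mem_insert_self a s)).add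
      (ih fun i hi => h i (Finset.mem_insert_of_mem hi))

lemma abs_crd_sub_le (hτ : 0 < τ) (k : ℕ) (x y : Plane) :
    |crd τ k x - crd τ k y| ≤ τ⁻¹ * ‖x - y‖ := by
  have h := PiLp.norm_apply_le (x - y) (par k)
  rw [Real.norm_eq_abs] at h
  have e : crd τ k x - crd τ k y = τ⁻¹ * (x - y) (par k) := by
    simp only [crd, PiLp.sub_apply]
    ring
  rw [e, abs_mul, abs_of_pos (inv_pos.2 hτ)]
  exact mul_le_mul_of_nonneg_left h (inv_pos.2 hτ).le

lemma BddLip.crd {a : ℝ → ℝ} (ha : BddLip a) (hτ : 0 < τ) (k : ℕ) :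
    ∃ M, 0 ≤ M ∧ ∀ x y : Plane, |a (crd τ k x)| ≤ M ∧
      |a (crd τ k x) - a (crd τ k y)| ≤ M * ‖x - y‖ := by
  obtain ⟨M, hM⟩ := ha
  have hM0 : 0 ≤ M := (abs_nonneg _).trans (hM 0 0).1
  have hi := inv_pos.2 hτ
  refine ⟨M + M * τ⁻¹, by positivity, fun x y => ⟨?_, ?_⟩⟩
  · have := (hM 0 (Staircase.crd τ k x)).1
    have : 0 ≤ M * τ⁻¹ := by positivity
    linarith
  · refine (hM _ _).2.trans ((mul_le_mul_of_nonneg_left (abs_crd_sub_le hτ k x y) hM0).trans ?_)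
    have : 0 ≤ M * ‖x - y‖ := by positivity
    linarith

lemma lipGrad_crd {a a' : ℝ → ℝ} (h : ∀ t, HasDerivAt a (a' t) t) (ha' : BddLip a') (hτ : 0 < τ)
    (k : ℕ) : LipGrad fun x => a (crd τ k x) := by
  obtain ⟨M, _, hM⟩ := ha'.crd hτ k
  refine ⟨fun x => (a' (crd τ k x) / τ) • dir k, M / τ, fun x y =>
    ⟨hasGradientAt_crd (h _), ?_⟩⟩
  rw [← sub_smul, norm_smul, norm_dir, mul_one, ← sub_div, Real.norm_eq_abs, abs_div,
    abs_of_pos hτ, div_mul_eq_mul_div]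
  exact div_le_div_of_nonneg_right (hM x y).2 hτ.le

lemma abs_mul_sub_mul_le {p q r s M N d : ℝ} (hq : |q| ≤ M) (hr : |r| ≤ N)
    (hM : |p - q| ≤ M * d) (hN : |r - s| ≤ N * d) :
    |p * r - q * s| ≤ 2 * M * N * d := by
  have e : p * r - q * s = (p - q) * r + q * (r - s) := by ring
  rw [e]
  refine (abs_add_le _ _).trans ?_
  rw [abs_mul, abs_mul]
  have h1 := mul_le_mul hM hr (abs_nonneg _) ((abs_nonneg _).trans hM)
  have h2 := mul_le_mul hq hN (abs_nonneg _) ((abs_nonneg _).trans hq)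
  linarith

/-- The gradient of a product is Lipschitz if the factors and their derivatives are bounded and
Lipschitz. -/
lemma lipGrad_mul_crd {a a' b b' : ℝ → ℝ} (ha : ∀ t, HasDerivAt a (a' t) t)
    (hb : ∀ t, HasDerivAt b (b' t) t) (ha0 : BddLip a) (ha1 : BddLip a') (hb0 : BddLip b)
    (hb1 : BddLip b') (hτ : 0 < τ) (j k : ℕ) :
    LipGrad fun x => a (crd τ j x) * b (crd τ k x) := by
  obtain ⟨A, _, hA⟩ := ha0.crd hτ j
  obtain ⟨A', _, hA'⟩ := ha1.crd hτ j
  obtain ⟨B, _, hB⟩ := hb0.crd hτ k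
  obtain ⟨B', _, hB'⟩ := hb1.crd hτ k
  refine ⟨fun x => a (crd τ j x) • ((b' (crd τ k x) / τ) • dir k) +
    b (crd τ k x) • ((a' (crd τ j x) / τ) • dir j), (2 * A * B' + 2 * B * A') / τ, fun x y =>
    ⟨hasGradientAt_mul (hasGradientAt_crd (ha _)) (hasGradientAt_crd (hb _)), ?_⟩⟩
  have h1 := abs_mul_sub_mul_le (hA y x).1 (hB' x y).1 (hA x y).2 (hB' x y).2
  have h2 := abs_mul_sub_mul_le (hB y x).1 (hA' x y).1 (hB x y).2 (hA' x y).2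
  have key : ∀ (p q r s : ℝ) (l : ℕ), ‖p • ((r / τ) • dir l) - q • ((s / τ) • dir l)‖
      = |p * r - q * s| / τ := by
    intro p q r s l
    rw [smul_smul, smul_smul, ← sub_smul, norm_smul, norm_dir, mul_one, Real.norm_eq_abs,
      ← mul_div_assoc, ← mul_div_assoc, ← sub_div, abs_div, abs_of_pos hτ]
  rw [add_sub_add_comm]
  refine (norm_add_le _ _).trans ?_
  rw [key, key, ← add_div, div_mul_eq_mul_div]
  exact div_le_div_of_nonneg_right (by linarith) hτ.le

/-- An explicit objective on the whole plane: each factor `step` switches on the change of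
curvature in the following buffer, and stays constant from there on. -/
def extension (ρ L τ : ℝ) (n : ℕ) (x : Plane) : ℝ :=
  L * τ ^ 2 * (prof ρ (crd τ 0 x) + prof ρ (crd τ 1 x + 2)
    + ∑ j ∈ Finset.range (n - 2), step (crd τ j x) * corr ρ (crd τ (j + 1) x))

lemma lipGrad_extension (hτ : 0 < τ) (ρ : ℝ) (n : ℕ) : LipGrad (extension ρ L τ n) := by
  refine LipGrad.const_mul (((lipGrad_crd (hasDerivAt_prof ρ) (bddLip_dprof ρ) hτ 0).add ?_).add
    (lipGrad_sum _ _ fun j _ => lipGrad_mul_crd hasDerivAt_step (hasDerivAt_corr ρ) bddLip_step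
      bddLip_dstep (bddLip_corr ρ) (bddLip_dcorr ρ) hτ j (j + 1))) (L * τ ^ 2)
  exact lipGrad_crd (a := fun t => prof ρ (t + 2)) (a' := fun t => dprof ρ (t + 2))
    (fun t => (hasDerivAt_prof ρ (t + 2)).comp_add_const t 2)
    ((bddLip_dprof ρ).comp_add_const 2) hτ 1

/-- The corrections telescope, since `crd (j + 2) = crd j - 2`. -/
lemma sum_corr (ρ τ : ℝ) (k : ℕ) (x : Plane) :
    prof ρ (crd τ 0 x) + prof ρ (crd τ 1 x + 2) + ∑ j ∈ Finset.range k, corr ρ (crd τ (j + 1) x)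
      = prof ρ (crd τ k x) + prof ρ (crd τ (k + 1) x + 2) - k * drop ρ := by
  induction k with
  | zero => simp
  | succ k ih =>
    rw [Finset.sum_range_succ, ← add_assoc, ih, corr, crd_add_two, sub_add_cancel]
    push_cast
    ring

/-- Before a strip every coordinate is at least `2`, and after it every coordinate is at most
`1`. -/
lemma crd_of_mem_strip {k : ℕ} {x : Plane} (hx : x ∈ strip τ k) (d : ℕ) :
    (∀ j, j + d + 1 = k → 2 ≤ crd τ j x) ∧ crd τ (k + d + 1) x ≤ 1 := by
  induction d using Nat.twoStepInduction with
  | zero =>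
    refine ⟨?_, hx.2.2⟩
    rintro j rfl
    have := crd_add_two τ j x
    have := hx.2.1
    simp only [add_zero, add_assoc, one_add_one_eq_two] at *
    linarith
  | one =>
    refine ⟨?_, ?_⟩
    · rintro j rfl
      have := crd_add_two τ j x
      have := hx.1.1
      simp only [add_assoc, one_add_one_eq_two] at *
      linarith
    · have := crd_add_two τ k x
      have := hx.1.2
      simp only [add_assoc, one_add_one_eq_two] at *
      linarith
  | more d ih _ =>
    refine ⟨?_, ?_⟩
    · rintro j rfl
      have h := ih.1 (j + 2) (by omega)
      rw [crd_add_two] at h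
      linarith
    · have := ih.2
      rw [show k + (d + 2) + 1 = k + d + 1 + 2 by omega, crd_add_two]
      linarith

lemma extension_eq_stripFun {n k : ℕ} (hk : k + 2 ≤ n) (ρ : ℝ) {x : Plane} (hx : x ∈ strip τ k) :
    extension ρ L τ n x = stripFun ρ L τ n k x := by
  have hs : ∑ j ∈ Finset.range (n - 2), step (crd τ j x) * corr ρ (crd τ (j + 1) x)
      = ∑ j ∈ Finset.range k, corr ρ (crd τ (j + 1) x)
        + (if k + 2 = n then 0 else 1) * (step (crd τ k x) * corr ρ (crd τ (k + 1) x)) := by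
    have e1 : ∑ j ∈ Finset.range k, step (crd τ j x) * corr ρ (crd τ (j + 1) x)
        = ∑ j ∈ Finset.range k, corr ρ (crd τ (j + 1) x) := by
      refine Finset.sum_congr rfl fun j hj => ?_
      have := Finset.mem_range.1 hj
      rw [step_of_ge ((crd_of_mem_strip hx (k - j - 1)).1 j (by omega)), one_mul]
    rcases hk.eq_or_lt with h | h
    · rw [if_pos h, zero_mul, add_zero, ← e1, show n - 2 = k by omega]
    · obtain ⟨d, rfl⟩ : ∃ d, n = k + 1 + d + 2 := ⟨n - k - 3, by omega⟩
      rw [if_neg h.ne, one_mul, show k + 1 + d + 2 - 2 = k + 1 + d by omega,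
        Finset.sum_range_add, Finset.sum_range_succ, e1, add_eq_left]
      refine Finset.sum_eq_zero fun j _ => ?_
      have := (crd_of_mem_strip hx j).2
      rw [step_of_le (by rwa [show k + 1 + j = k + j + 1 by ring]), zero_mul]
  rw [extension, hs, ← add_assoc, sum_corr, stripFun]
  ring

lemma isObjective_extension (hτ : 0 < τ) (hL : 0 < L) {n : ℕ} (hn : 2 ≤ n) :
    IsObjective γ L τ n (extension (γ / L) L τ n) := by
  obtain ⟨G, M, hG⟩ := lipGrad_extension (L := L) hτ (γ / L) n
  refine ⟨fun x => (hG x x).1.differentiableAt, ⟨M.toNNReal, ?_⟩, ?_, ?_⟩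
  · rw [_root_.gradient_eq fun x => (hG x x).1]
    exact LipschitzWith.of_dist_le' fun x y => by
      rw [dist_eq_norm, dist_eq_norm]
      exact (hG x y).2
  · intro i h1 h2 x hx
    obtain ⟨k, rfl⟩ : ∃ k, i = k + 1 := ⟨i - 1, by omega⟩
    rcases h2.eq_or_lt with h | h
    · obtain ⟨j, rfl⟩ : ∃ j, k = j + 1 := ⟨k - 1, by omega⟩
      rw [extension_eq_stripFun h2 _ ((mem_strip_iff hτ j x).2 (.inr (.inr hx))),
        stripFun_eq_blockFun_succ hτ hL hx]
    · rw [extension_eq_stripFun h _ ((mem_strip_iff hτ k x).2 (.inl hx)),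
        stripFun_eq_blockFun hτ hL h hx]
  · intro i h1 h2 x hx
    obtain ⟨k, rfl⟩ : ∃ k, i = k + 1 := ⟨i - 1, by omega⟩
    rw [extension_eq_stripFun h2 _ ((mem_strip_iff hτ k x).2 (.inr (.inl hx))),
      stripFun_eq_bufferFun hτ hL hx]

/-! ### Critical points -/

lemma slope_of_le_one (ρ ε v : ℝ) {u : ℝ} (hu : u ∈ Set.Icc (0 : ℝ) 1) :
    slope ρ ε u v = 2 * curv ρ u * (u - 1 / 2) := by
  rw [slope, dprof_of_mem_zero_one ρ hu, dstep_of_le hu.2]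
  ring

lemma slope_of_mem_one_two (ρ ε : ℝ) {u v : ℝ} (hu : u ∈ Set.Icc (1 : ℝ) 2)
    (hv : v ∈ Set.Icc (0 : ℝ) 1) :
    slope ρ ε u v
      = -ρ - (1 - ρ) * (u - 1) + ε * (dstep u * ((curv ρ v - 1) * (v - 1 / 2) ^ 2)) := by
  rw [slope, dprof_of_mem_one_two ρ hu, corr_of_mem ρ hv]

lemma slope_of_mem_two_three (ρ ε v : ℝ) {u : ℝ} (hu : u ∈ Set.Icc (2 : ℝ) 3) :
    slope ρ ε u v = 2 * (u - 5 / 2) := by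
  rw [slope, dprof_of_mem_two_three ρ hu, dstep_of_ge hu.1]
  ring

lemma crossSlope_eq (ρ ε u : ℝ) {v : ℝ} (hv : v ∈ Set.Icc (0 : ℝ) 1) :
    crossSlope ρ ε u v = 2 * (1 + ε * (step u * (curv ρ v - 1))) * (v - 1 / 2) := by
  rw [crossSlope, dprof_of_mem_two_three ρ ⟨by linarith [hv.1], by linarith [hv.2]⟩,
    dcorr_of_mem ρ hv]
  ring

/-- In a buffer there is no critical point: below the center line the cross slope is nonzero, and
on it or above it the slope is negative. -/
lemma eq_half_of_slope_eq_zero {ρ ε u v : ℝ} (hρ : 0 < ρ) (hρ1 : ρ ≤ 1 / 2) (hε : ε = 0 ∨ ε = 1)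
    (hu : u ∈ Set.Icc (0 : ℝ) 3) (hv : v ∈ Set.Icc (0 : ℝ) 1) (h1 : slope ρ ε u v = 0)
    (h2 : crossSlope ρ ε u v = 0) : (u = 1 / 2 ∨ u = 5 / 2) ∧ v = 1 / 2 := by
  rw [crossSlope_eq ρ ε u hv] at h2
  rcases le_total u 1 with hu1 | hu1
  · rw [slope_of_le_one ρ ε v ⟨hu.1, hu1⟩] at h1
    rw [step_of_le hu1] at h2
    refine ⟨.inl ?_, by linarith⟩
    have : curv ρ u ≠ 0 := by unfold curv; split_ifs <;> linarith
    have := (mul_eq_zero.1 h1).resolve_left (mul_ne_zero two_ne_zero this)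
    linarith
  rcases le_total u 2 with hu2 | hu2
  · exfalso
    rw [slope_of_mem_one_two ρ ε ⟨hu1, hu2⟩ hv] at h1
    have hS := step_nonneg u
    have hD := dstep_nonneg u
    have hneg : 0 ≤ (1 - ρ) * (u - 1) := mul_nonneg (by linarith) (by linarith)
    rcases lt_or_ge v (1 / 2) with h | h
    · rw [curv, if_pos h.le] at h2
      have : 0 < 1 + ε * (step u * (4 - 1)) := by rcases hε with rfl | rfl <;> linarith
      have : v - 1 / 2 ≠ 0 := by linarith
      exact this ((mul_eq_zero.1 h2).resolve_left (by positivity))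
    · have hle : ε * (dstep u * ((curv ρ v - 1) * (v - 1 / 2) ^ 2)) ≤ 0 := by
        rcases h.eq_or_lt with rfl | h
        · simp
        · rw [curv, if_neg (not_le.2 h)]
          have : 0 ≤ dstep u * ((1 + ρ) * (v - 1 / 2) ^ 2) := by positivity
          rcases hε with rfl | rfl <;> linarith
      linarith
  · rw [slope_of_mem_two_three ρ ε v ⟨hu2, hu.2⟩] at h1
    rw [step_of_ge hu2] at h2
    refine ⟨.inr (by linarith), ?_⟩
    have : 2 * (1 + ε * (1 * (curv ρ v - 1))) ≠ 0 := by
      unfold curv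
      rcases hε with rfl | rfl <;> split_ifs <;> intro _ <;> linarith
    have := (mul_eq_zero.1 h2).resolve_left this
    linarith

lemma IsObjective.eq_near_center {n : ℕ} {f : Plane → ℝ} (hf : IsObjective γ L τ n f) (hτ : 0 < τ)
    (hL : 0 < L) {k : ℕ} (hk : k + 2 ≤ n) {a b : ℝ} (ha : a ∈ Set.Icc (0 : ℝ) (1 / 2))
    (hb : b ∈ Set.Icc (0 : ℝ) (1 / 2)) :
    f (center τ (k + 1) - (τ * (-1)) • (a • dir k + b • dir (k + 1)))
      = f (center τ (k + 1)) + L * τ ^ 2 * (b ^ 2 - γ / L * a ^ 2) := by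
  obtain ⟨hu, hv⟩ := crd_center hτ k
  obtain ⟨hu', hv'⟩ := crd_smul_dir τ (-1) k (center τ (k + 1)) hτ a b
  rw [hu] at hu'
  rw [hv] at hv'
  have hc : center τ (k + 1) ∈ block τ (k + 1) := by
    rw [mem_block_iff hτ, hu, hv]
    norm_num
  rw [hf.eq_on_block (k + 1) (by omega) (by omega) _ hc,
    hf.eq_on_block (k + 1) (by omega) (by omega), blockFun_eq hτ hL, blockFun_eq hτ hL, hu', hv', hu, hv,
    if_neg (by omega)]
  · rcases ha.1.eq_or_lt with rfl | h
    · ring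
    · rw [curv, if_neg (by linarith : ¬ 1 / 2 - -1 * a ≤ 1 / 2)]
      ring
  · rw [mem_block_iff hτ, hu', hv']
    exact ⟨⟨by linarith [ha.1], by linarith [ha.2]⟩, ⟨by linarith [hb.1], by linarith [hb.2]⟩⟩

/-- The ray from a center `c` in the direction `a • dir k + b • dir (k + 1)` meets every
neighborhood of `c`. -/
lemma exists_ray_of_eventually {P : Plane → Prop} (c : Plane) (τ : ℝ) (k : ℕ) (a b : ℝ)
    (h : ∀ᶠ x in nhds c, P x) :
    ∃ s ∈ Set.Ioc (0 : ℝ) (1 / 2),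
      P (c - (τ * (-1)) • ((s * a) • dir k + (s * b) • dir (k + 1))) := by
  have hc : Continuous fun s : ℝ => c - (τ * (-1)) • ((s * a) • dir k + (s * b) • dir (k + 1)) := by
    fun_prop
  have ht := hc.tendsto 0
  simp only [zero_mul, zero_smul, add_zero, smul_zero, sub_zero] at ht
  have h1 := (ht.eventually h).filter_mono (nhdsWithin_le_nhds (s := Set.Ioi 0))
  obtain ⟨s, hs, hs'⟩ := (h1.and (Ioc_mem_nhdsGT (by norm_num : (0 : ℝ) < 1 / 2))).exists
  exact ⟨s, hs', hs⟩

lemma IsObjective.isSaddlePoint {n : ℕ} {f : Plane → ℝ} (hf : IsObjective γ L τ n f) (hτ : 0 < τ)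
    (hγ : 0 < γ) (hL : 0 < L) {k : ℕ} (hk : k + 2 ≤ n) : IsSaddlePoint f (center τ (k + 1)) := by
  obtain ⟨hu, hv⟩ := crd_center hτ k
  refine ⟨?_, fun h => ?_, fun h => ?_⟩
  · rw [hf.gradient_eq hτ hL hk (by rw [strip, Set.mem_ofPred_eq, hu, hv]; norm_num), hu, hv,
      slope_of_le_one _ _ _ (by norm_num), crossSlope_eq _ _ _ (by norm_num)]
    simp
  · obtain ⟨s, hs, h⟩ := exists_ray_of_eventually _ τ k 1 0 h
    rw [mul_one, mul_zero, hf.eq_near_center hτ hL hk ⟨hs.1.le, hs.2⟩ (by norm_num)] at h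
    have : 0 < L * τ ^ 2 * (γ / L * s ^ 2) := by have := hs.1; positivity
    linarith
  · obtain ⟨s, hs, h⟩ := exists_ray_of_eventually _ τ k 0 1 h
    rw [mul_one, mul_zero, hf.eq_near_center hτ hL hk (by norm_num) ⟨hs.1.le, hs.2⟩] at h
    have : 0 < L * τ ^ 2 * s ^ 2 := by have := hs.1; positivity
    linarith

lemma IsObjective.isLocalMin_center {k : ℕ} {f : Plane → ℝ} (hf : IsObjective γ L τ (k + 1) f)
    (hτ : 0 < τ) (hL : 0 < L) : IsLocalMin f (center τ (k + 1)) := by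
  obtain ⟨hu, hv⟩ := crd_center hτ k
  have hc : center τ (k + 1) ∈ block τ (k + 1) := by
    rw [mem_block_iff hτ, hu, hv]
    norm_num
  filter_upwards [(continuous_crd τ k).continuousAt.preimage_mem_nhds
    (Icc_mem_nhds (by rw [hu]; norm_num : (0 : ℝ) < _) (by rw [hu]; norm_num : _ < (1 : ℝ))),
    (continuous_crd τ (k + 1)).continuousAt.preimage_mem_nhds
    (Icc_mem_nhds (by rw [hv]; norm_num : (0 : ℝ) < _) (by rw [hv]; norm_num : _ < (1 : ℝ)))]
    with x hx hx'
  rw [hf.eq_on_block (k + 1) (by omega) le_rfl _ hc,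
    hf.eq_on_block (k + 1) (by omega) le_rfl x ((mem_block_iff hτ k x).2 ⟨hx, hx'⟩),
    blockFun_eq hτ hL, blockFun_eq hτ hL, hu, hv, if_pos rfl, if_pos rfl]
  refine mul_le_mul_of_nonneg_left ?_ (by positivity)
  linarith [sq_nonneg (crd τ k x - 1 / 2), sq_nonneg (crd τ (k + 1) x - 1 / 2)]

lemma IsObjective.eq_center_of_isLocalMin {n : ℕ} {f : Plane → ℝ} (hf : IsObjective γ L τ n f)
    (hτ : 0 < τ) (hγ : 0 < γ) (hL : 2 * γ ≤ L) (hn : 2 ≤ n) {z : Plane} (hz : z ∈ region τ n)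
    (h : IsLocalMin f z) : z = center τ n := by
  have hL0 : 0 < L := by linarith
  obtain ⟨k, hk, hzk⟩ := (mem_region_iff hτ hn z).1 hz
  have hgrad : gradient f z = 0 := by rw [gradient, h.fderiv_eq_zero, map_zero]
  rw [hf.gradient_eq hτ hL0 hk hzk] at hgrad
  have hgrad' := (smul_eq_zero.1 hgrad).resolve_left (by positivity)
  have h1 := crd_smul_dir 1 1 k 0 one_pos
    (slope (γ / L) (if k + 2 = n then 0 else 1) (crd τ k z) (crd τ (k + 1) z))
    (crossSlope (γ / L) (if k + 2 = n then 0 else 1) (crd τ k z) (crd τ (k + 1) z))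
  rw [hgrad', smul_zero, sub_zero] at h1
  have hε : (if k + 2 = n then (0 : ℝ) else 1) = 0 ∨ (if k + 2 = n then (0 : ℝ) else 1) = 1 := by
    split_ifs <;> simp
  obtain ⟨hu, hv⟩ := eq_half_of_slope_eq_zero (div_pos hγ hL0)
    (by rw [div_le_iff₀ hL0]; linarith) hε hzk.1 hzk.2
    (by linarith [h1.1]) (by linarith [h1.2])
  rcases hu with hu | hu
  · obtain ⟨hcu, hcv⟩ := crd_center hτ k
    have := eq_of_crd_eq hτ k (hu.trans hcu.symm) (hv.trans hcv.symm)
    subst this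
    exact ((hf.isSaddlePoint hτ hγ hL0 hk).2.1 h).elim
  · obtain ⟨hcu, hcv⟩ := crd_center hτ (k + 1)
    rw [add_assoc] at hcu hcv
    have hu' : crd τ (k + 2) z = 1 / 2 := by rw [crd_add_two, hu]; norm_num
    have := eq_of_crd_eq hτ (k + 1) (hv.trans hcu.symm) (hu'.trans hcv.symm)
    subst this
    rcases hk.eq_or_lt with rfl | hk
    · rfl
    · exact ((hf.isSaddlePoint (k := k + 1) hτ hγ hL0 (by omega)).2.1 h).elim

/-! ### One step of gradient descent -/

lemma abs_step_block_le {ρ u : ℝ} (hρ : 0 < ρ) :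
    |u - 2 * curv ρ u * (u - 1 / 2) / 4 - 1 / 2| ≤ (1 + ρ / 2) * |u - 1 / 2| := by
  unfold curv
  split_ifs
  · rw [show u - 2 * 4 * (u - 1 / 2) / 4 - 1 / 2 = -(u - 1 / 2) by ring, abs_neg]
    nlinarith [abs_nonneg (u - 1 / 2)]
  · rw [show u - 2 * -ρ * (u - 1 / 2) / 4 - 1 / 2 = (1 + ρ / 2) * (u - 1 / 2) by ring, abs_mul,
      abs_of_pos (by linarith : 0 < 1 + ρ / 2)]

lemma step_block_nonneg {ρ u : ℝ} (hρ : 0 < ρ) :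
    0 ≤ u - 2 * curv ρ u * (u - 1 / 2) / 4 := by
  unfold curv
  split_ifs with h
  · linarith
  · nlinarith [not_le.1 h]

/-- Before a transition to curvature `4L` the transversal offset may change its sign but does not
grow, and before one to curvature `-γ` it keeps its sign and grows by at most `1 + γ / (2L)`. -/
lemma step_across_buffer {ρ ε u v : ℝ} (hρ : 0 < ρ) (hε : ε = 0 ∨ ε = 1)
    (hv : v ∈ Set.Icc (0 : ℝ) 1) :
    |v - crossSlope ρ ε u v / 4 - 1 / 2| ≤ (1 + ρ / 2) * |v - 1 / 2| ∧
    (v - crossSlope ρ ε u v / 4 < 1 / 2 →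
      v < 1 / 2 ∧ |v - crossSlope ρ ε u v / 4 - 1 / 2| ≤ |v - 1 / 2|) := by
  have hS := step_nonneg u
  have hS1 := step_le_one u
  rw [crossSlope_eq ρ ε u hv]
  have e : v - 2 * (1 + ε * (step u * (curv ρ v - 1))) * (v - 1 / 2) / 4 - 1 / 2
      = (1 - (1 + ε * (step u * (curv ρ v - 1))) / 2) * (v - 1 / 2) := by ring
  rcases lt_or_ge v (1 / 2) with h | h
  · have h1 : |v - 2 * (1 + ε * (step u * (curv ρ v - 1))) * (v - 1 / 2) / 4 - 1 / 2|
        ≤ |v - 1 / 2| := by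
      rw [e, abs_mul, curv, if_pos h.le]
      refine mul_le_of_le_one_left (abs_nonneg _) ?_
      rw [abs_le]
      rcases hε with rfl | rfl <;> constructor <;> linarith
    exact ⟨h1.trans (le_mul_of_one_le_left (abs_nonneg _) (by linarith)), fun _ => ⟨h, h1⟩⟩
  · rcases h.eq_or_lt with rfl | h'
    · norm_num
    · have h2 : 0 ≤ step u * (1 + ρ) := by positivity
      have h3 : step u * (1 + ρ) ≤ 1 * (1 + ρ) := mul_le_mul_of_nonneg_right hS1 (by linarith)
      rw [curv, if_neg (not_le.2 h')] at e ⊢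
      have h4 : 0 ≤ 1 - (1 + ε * (step u * (-ρ - 1))) / 2 := by
        rcases hε with rfl | rfl <;> linarith
      have h5 : 1 - (1 + ε * (step u * (-ρ - 1))) / 2 ≤ 1 + ρ / 2 := by
        rcases hε with rfl | rfl <;> linarith
      refine ⟨?_, fun hlt => ?_⟩
      · rw [e, abs_mul, abs_of_nonneg h4]
        exact mul_le_mul_of_nonneg_right h5 (abs_nonneg _)
      · have := mul_nonneg h4 (sub_nonneg.2 h)
        linarith

/-- In a buffer the iterates advance by at least `γ τ / (5L)`, provided that the transversal offset
is small when it lies on the side of the larger curvature, and do not overshoot the next block. -/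
lemma step_along_buffer {ρ ε u v : ℝ} (hρ : 0 < ρ) (hρ1 : ρ ≤ 1 / 2) (hε : ε = 0 ∨ ε = 1)
    (hu : u ∈ Set.Icc (1 : ℝ) 2) (hv : v ∈ Set.Icc (0 : ℝ) 1)
    (hsmall : v < 1 / 2 → (v - 1 / 2) ^ 2 ≤ ρ / 30) :
    u + ρ / 5 ≤ u - slope ρ ε u v / 4 ∧ u - slope ρ ε u v / 4 ≤ 3 := by
  have hD := dstep_nonneg u
  have hD2 := dstep_le_two u
  have hw : (v - 1 / 2) ^ 2 ≤ 1 / 4 := by nlinarith [hv.1, hv.2]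
  have h0 : 0 ≤ (1 - ρ) * (u - 1) := mul_nonneg (by linarith) (by linarith [hu.1])
  have h1 : (1 - ρ) * (u - 1) ≤ 1 - ρ := mul_le_of_le_one_right (by linarith) (by linarith [hu.2])
  rw [slope_of_mem_one_two ρ ε hu hv]
  have h2 : dstep u * (v - 1 / 2) ^ 2 ≤ 2 * (v - 1 / 2) ^ 2 :=
    mul_le_mul_of_nonneg_right hD2 (sq_nonneg _)
  have h3 : 0 ≤ dstep u * (v - 1 / 2) ^ 2 := by positivity
  rcases le_or_gt v (1 / 2) with h | h
  · have hs : (v - 1 / 2) ^ 2 ≤ ρ / 30 := by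
      rcases h.eq_or_lt with rfl | h
      · norm_num; linarith
      · exact hsmall h
    rw [curv, if_pos h]
    rcases hε with rfl | rfl <;> constructor <;> linarith [hu.2]
  · rw [curv, if_neg (not_le.2 h)]
    have h4 : 0 ≤ ρ * (dstep u * (v - 1 / 2) ^ 2) := by positivity
    have h5 : ρ * (dstep u * (v - 1 / 2) ^ 2) ≤ 1 / 2 * (dstep u * (v - 1 / 2) ^ 2) :=
      mul_le_mul_of_nonneg_right hρ1 h3
    rcases hε with rfl | rfl <;> constructor <;> linarith [hu.2]

lemma IsGradientDescent.crd_succ {n : ℕ} {f : Plane → ℝ} (hf : IsObjective γ L τ n f) (hτ : 0 < τ)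
    (hL : 0 < L) {x : ℕ → Plane} (hx : IsGradientDescent f (1 / (4 * L)) x) {k : ℕ}
    (hk : k + 2 ≤ n) {t : ℕ} (ht : x t ∈ strip τ k) :
    crd τ k (x (t + 1)) = crd τ k (x t) -
      slope (γ / L) (if k + 2 = n then 0 else 1) (crd τ k (x t)) (crd τ (k + 1) (x t)) / 4 ∧
    crd τ (k + 1) (x (t + 1)) = crd τ (k + 1) (x t) -
      crossSlope (γ / L) (if k + 2 = n then 0 else 1) (crd τ k (x t)) (crd τ (k + 1) (x t)) / 4 := by
  have h := crd_smul_dir τ (1 / 4) k (x t) hτ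
    (slope (γ / L) (if k + 2 = n then 0 else 1) (crd τ k (x t)) (crd τ (k + 1) (x t)))
    (crossSlope (γ / L) (if k + 2 = n then 0 else 1) (crd τ k (x t)) (crd τ (k + 1) (x t)))
  rw [hx t, hf.gradient_eq hτ hL hk ht, smul_smul,
    show 1 / (4 * L) * (L * τ) = τ * (1 / 4) by field_simp, h.1, h.2]
  constructor <;> ring

/-! ### The time spent in each block -/

/-- A lower bound for the number of steps spent in block `k + 1`.  The summand `6` makes room in
the recursion `exponent_le` for the growth of the offset in the buffers. -/
def wait (ρ : ℝ) (k : ℕ) : ℝ := (1 / ρ) ^ (k + 1) + 6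

lemma le_wait {ρ : ℝ} (hρ : 0 < ρ) (hρ1 : ρ ≤ 1 / 2) (k : ℕ) :
    1 / ρ + 6 ≤ wait ρ k ∧ 8 ≤ wait ρ k := by
  have h2 : 2 ≤ 1 / ρ := by rw [le_div_iff₀ hρ]; linarith
  have := le_self_pow₀ (by linarith : 1 ≤ 1 / ρ) (by omega : k + 1 ≠ 0)
  unfold wait
  constructor <;> linarith

/-- The gradient descent is in block `k + 1`, for `N` steps so far.  The offset across the strip
has been halved `N` times, where `1 / 2 ≤ exp (-0.69)`; the one along the strip started at no more
than `exp (-(ρ / 2) * wait ρ k) / 2` and has grown by at most `1 + ρ / 2` in each step. -/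
structure InBlock (ρ τ : ℝ) (n t : ℕ) (x : Plane) (k N : ℕ) : Prop where
  le_n : k + 2 ≤ n
  le_t : N ≤ t
  mem : crd τ k x ∈ Set.Icc (0 : ℝ) 1
  across : |crd τ (k + 1) x - 1 / 2| ≤ 1 / 2 * Real.exp (-(69 / 100) * N)
  along : |crd τ k x - 1 / 2| ≤ 1 / 2 * Real.exp (ρ / 2 * (N - wait ρ k))

/-- The gradient descent is in the buffer behind block `k + 1`, for `s` steps so far, after `N`
steps in that block.  On the side where the curvature increases, the offset across the strip slows
down the motion along it, but on that side it has not grown since the block was left. -/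
structure InBuffer (ρ τ : ℝ) (n t : ℕ) (x : Plane) (k N s : ℕ) : Prop where
  le_n : k + 2 ≤ n
  le_t : N ≤ t
  wait_le : wait ρ k ≤ N
  mem : crd τ k x ∈ Set.Icc (1 : ℝ) 2
  progress : 1 + ρ / 5 * s ≤ crd τ k x
  across_neg : crd τ (k + 1) x < 1 / 2 →
    |crd τ (k + 1) x - 1 / 2| ≤ 1 / 2 * Real.exp (-(69 / 100) * N)
  across : |crd τ (k + 1) x - 1 / 2| ≤ 1 / 2 * Real.exp (-(69 / 100) * N + ρ / 2 * s)

/-- The gradient descent has reached the final block. -/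
structure InFinal (ρ τ : ℝ) (n t : ℕ) (x : Plane) (k : ℕ) : Prop where
  eq_n : k + 2 = n
  wait_le : wait ρ k ≤ t
  mem : crd τ k x ∈ Set.Icc (2 : ℝ) 3
  across : crd τ (k + 1) x ∈ Set.Icc (0 : ℝ) 1

/-- The invariant of the gradient descent. -/
def Inv (ρ τ : ℝ) (n t : ℕ) (x : Plane) : Prop :=
  (∃ k N, InBlock ρ τ n t x k N) ∨ (∃ k N s, InBuffer ρ τ n t x k N s) ∨
    ∃ k, InFinal ρ τ n t x k

lemma mem_Icc_of_abs_le {v : ℝ} (h : |v - 1 / 2| ≤ 1 / 2) : v ∈ Set.Icc (0 : ℝ) 1 := by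
  rw [abs_le] at h
  constructor <;> linarith

lemma half_exp_le_half {y : ℝ} (h : y ≤ 0) : 1 / 2 * Real.exp y ≤ 1 / 2 := by
  have := Real.exp_le_one_iff.2 h
  linarith

lemma InBlock.mem_strip {ρ : ℝ} {n t k N : ℕ} {x : Plane} (h : InBlock ρ τ n t x k N) :
    x ∈ strip τ k :=
  ⟨⟨h.mem.1, by linarith [h.mem.2]⟩, mem_Icc_of_abs_le
    (h.across.trans (half_exp_le_half (by have : (0 : ℝ) ≤ N := N.cast_nonneg; linarith)))⟩

/-- The buffer has length `1` and is passed in steps of `ρ / 5` at least. -/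
lemma InBuffer.time_le {ρ : ℝ} {n t k N s : ℕ} {x : Plane} (h : InBuffer ρ τ n t x k N s) :
    ρ * s ≤ 5 := by
  linarith [h.progress, h.mem.2]

lemma InBuffer.mem_strip {ρ : ℝ} (hρ : 0 < ρ) (hρ1 : ρ ≤ 1 / 2) {n t k N s : ℕ} {x : Plane}
    (h : InBuffer ρ τ n t x k N s) : x ∈ strip τ k :=
  ⟨⟨by linarith [h.mem.1], by linarith [h.mem.2]⟩, mem_Icc_of_abs_le
    (h.across.trans (half_exp_le_half
      (by linarith [h.time_le, (le_wait hρ hρ1 k).2, h.wait_le])))⟩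

lemma half_mul_exp_le (y : ℝ) : Real.exp y / 2 ≤ Real.exp (y - 69 / 100) := by
  have h : Real.exp (69 / 100) ≤ 2 := by
    rw [← Real.le_log_iff_exp_le (by norm_num)]
    linarith [Real.log_two_gt_d9]
  rw [Real.exp_sub]
  exact div_le_div_of_nonneg_left (Real.exp_pos _).le (Real.exp_pos _) h

lemma one_add_mul_exp_le {ρ : ℝ} (y : ℝ) :
    (1 + ρ / 2) * Real.exp y ≤ Real.exp (y + ρ / 2) := by
  rw [Real.exp_add, mul_comm]
  exact mul_le_mul_of_nonneg_left (by linarith [Real.add_one_le_exp (ρ / 2)]) (Real.exp_pos _).le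

lemma InBlock.succ {n : ℕ} {f : Plane → ℝ} (hf : IsObjective γ L τ n f) (hτ : 0 < τ) (hγ : 0 < γ)
    (hL : 2 * γ ≤ L) {x : ℕ → Plane} (hx : IsGradientDescent f (1 / (4 * L)) x) {t k N : ℕ}
    (h : InBlock (γ / L) τ n t (x t) k N) : Inv (γ / L) τ n (t + 1) (x (t + 1)) := by
  have hL0 : 0 < L := by linarith
  have hρ : 0 < γ / L := div_pos hγ hL0
  have hρ1 : γ / L ≤ 1 / 2 := by rw [div_le_iff₀ hL0]; linarith
  have hst := h.mem_strip
  obtain ⟨hu, hv⟩ := hx.crd_succ hf hτ hL0 h.le_n hst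
  rw [slope_of_le_one _ _ _ h.mem] at hu
  rw [crossSlope_eq _ _ _ hst.2, step_of_le h.mem.2] at hv
  have halong : |crd τ k (x (t + 1)) - 1 / 2| ≤ (1 + γ / L / 2) * |crd τ k (x t) - 1 / 2| := by
    rw [hu]
    exact abs_step_block_le hρ
  have h0 : 0 ≤ crd τ k (x (t + 1)) := by
    rw [hu]
    exact step_block_nonneg hρ
  have hacross : |crd τ (k + 1) (x (t + 1)) - 1 / 2|
      ≤ 1 / 2 * Real.exp (-(69 / 100) * (N + 1 : ℕ)) := by
    have e : crd τ (k + 1) (x (t + 1)) - 1 / 2 = (crd τ (k + 1) (x t) - 1 / 2) / 2 := by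
      rw [hv]; ring
    rw [e, abs_div, abs_two]
    have := half_mul_exp_le (-(69 / 100) * N)
    rw [show -(69 / 100) * (N : ℝ) - 69 / 100 = -(69 / 100) * (N + 1 : ℕ) by push_cast; ring]
      at this
    linarith [h.across]
  have halong' : |crd τ k (x (t + 1)) - 1 / 2|
      ≤ 1 / 2 * Real.exp (γ / L / 2 * ((N + 1 : ℕ) - wait (γ / L) k)) := by
    have h1 := mul_le_mul_of_nonneg_left h.along (by linarith : 0 ≤ 1 + γ / L / 2)
    have h2 := one_add_mul_exp_le (ρ := γ / L) (γ / L / 2 * (N - wait (γ / L) k))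
    rw [show γ / L / 2 * (N - wait (γ / L) k) + γ / L / 2
      = γ / L / 2 * ((N + 1 : ℕ) - wait (γ / L) k) by push_cast; ring] at h2
    linarith
  rcases le_or_gt (crd τ k (x (t + 1))) 1 with h1 | h1
  · exact .inl ⟨k, N + 1, h.le_n, by have := h.le_t; omega, ⟨h0, h1⟩, hacross, halong'⟩
  · refine .inr (.inl ⟨k, N + 1, 0, h.le_n, by have := h.le_t; omega, ?_, ⟨h1.le, ?_⟩, ?_,
      fun _ => hacross, ?_⟩)
    · -- the offset exceeds `1 / 2`, so the exponent of its bound is positive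
      rw [abs_of_pos (by linarith)] at halong'
      have h2 : 1 < Real.exp (γ / L / 2 * ((N + 1 : ℕ) - wait (γ / L) k)) := by linarith
      have := pos_of_mul_pos_right (Real.one_lt_exp_iff.1 h2) (by linarith : 0 ≤ γ / L / 2)
      linarith
    · have h2 : |crd τ k (x t) - 1 / 2| ≤ 1 / 2 :=
        abs_le.2 ⟨by linarith [h.mem.1], by linarith [h.mem.2]⟩
      have h3 := le_abs_self (crd τ k (x (t + 1)) - 1 / 2)
      nlinarith [abs_nonneg (crd τ k (x t) - 1 / 2)]
    · simpa using h1.le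
    · simpa using hacross

/-- After a long stay in a block the offset is small enough for `step_along_buffer`. -/
lemma sq_half_exp_le {ρ N : ℝ} (hρ : 0 < ρ) (hN : 1 / ρ + 6 ≤ N) :
    (1 / 2 * Real.exp (-(69 / 100) * N)) ^ 2 ≤ ρ / 30 := by
  have hi : 0 < 1 / ρ := by positivity
  have h1 : 69 / 100 * N ≤ Real.exp (69 / 100 * N) := by
    linarith [Real.add_one_le_exp (69 / 100 * N)]
  have h2 : 8 * (1 / ρ) ≤ Real.exp (69 / 100 * N) ^ 2 := by
    have h3 : (69 / 100 * N) ^ 2 ≤ Real.exp (69 / 100 * N) ^ 2 :=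
      pow_le_pow_left₀ (by linarith) h1 2
    have h4 : (1 / ρ + 6) ^ 2 ≤ N ^ 2 := pow_le_pow_left₀ (by linarith) hN 2
    nlinarith [sq_nonneg (1 / ρ - 6)]
  rw [neg_mul, Real.exp_neg, mul_pow, inv_pow]
  have h5 : (Real.exp (69 / 100 * N) ^ 2)⁻¹ ≤ (8 * (1 / ρ))⁻¹ := inv_anti₀ (by positivity) h2
  have h6 : (8 * (1 / ρ))⁻¹ = ρ / 8 := by field_simp
  rw [h6] at h5
  linarith

/-- A stay of `N ≥ wait ρ k` steps in a block, followed by at most `5 / ρ + 1` steps in a buffer,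
leaves an offset in the next block that needs `wait ρ (k + 1)` steps to grow. -/
lemma exponent_le {ρ N s : ℝ} (hρ : 0 < ρ) (hρ1 : ρ ≤ 1 / 2) {k : ℕ} (hN : wait ρ k ≤ N)
    (hs : ρ * s ≤ 5) :
    -(69 / 100) * N + ρ / 2 * (s + 1) ≤ ρ / 2 * (0 - wait ρ (k + 1)) := by
  have h2 := (le_wait hρ hρ1 k).2
  have e : ρ * wait ρ (k + 1) = (1 / ρ) ^ (k + 1) + 6 * ρ := by
    rw [wait, pow_succ (1 / ρ) (k + 1)]
    field_simp
  unfold wait at hN h2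
  linarith

lemma InBuffer.succ {n : ℕ} {f : Plane → ℝ} (hf : IsObjective γ L τ n f) (hτ : 0 < τ) (hγ : 0 < γ)
    (hL : 2 * γ ≤ L) {x : ℕ → Plane} (hx : IsGradientDescent f (1 / (4 * L)) x) {t k N s : ℕ}
    (h : InBuffer (γ / L) τ n t (x t) k N s) : Inv (γ / L) τ n (t + 1) (x (t + 1)) := by
  have hL0 : 0 < L := by linarith
  have hρ : 0 < γ / L := div_pos hγ hL0
  have hρ1 : γ / L ≤ 1 / 2 := by rw [div_le_iff₀ hL0]; linarith
  have hst := h.mem_strip hρ hρ1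
  obtain ⟨hu, hv⟩ := hx.crd_succ hf hτ hL0 h.le_n hst
  have hε : (if k + 2 = n then (0 : ℝ) else 1) = 0 ∨ (if k + 2 = n then (0 : ℝ) else 1) = 1 := by
    split_ifs <;> simp
  obtain ⟨hv1, hv2⟩ := step_across_buffer (u := crd τ k (x t)) hρ hε hst.2
  obtain ⟨hu1, hu2⟩ := step_along_buffer hρ hρ1 hε h.mem hst.2 fun hneg => by
    rw [← sq_abs]
    exact (pow_le_pow_left₀ (abs_nonneg _) (h.across_neg hneg) 2).trans
      (sq_half_exp_le hρ ((le_wait hρ hρ1 k).1.trans h.wait_le))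
  rw [← hv] at hv1 hv2
  rw [← hu] at hu1 hu2
  have hacross : |crd τ (k + 1) (x (t + 1)) - 1 / 2|
      ≤ 1 / 2 * Real.exp (-(69 / 100) * N + γ / L / 2 * (s + 1)) := by
    have h1 := mul_le_mul_of_nonneg_left h.across (by linarith : 0 ≤ 1 + γ / L / 2)
    have h2 := one_add_mul_exp_le (ρ := γ / L) (-(69 / 100) * N + γ / L / 2 * s)
    rw [show -(69 / 100) * N + γ / L / 2 * s + γ / L / 2
      = -(69 / 100) * N + γ / L / 2 * (s + 1) by ring] at h2
    linarith
  have hle := h.le_t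
  rcases le_or_gt (crd τ k (x (t + 1))) 2 with h2 | h2
  · refine .inr (.inl ⟨k, N, s + 1, h.le_n, by omega, h.wait_le,
      ⟨by linarith [h.mem.1], h2⟩, ?_, fun hneg => ?_, ?_⟩)
    · push_cast
      linarith [h.progress]
    · exact (hv2 hneg).2.trans (h.across_neg (hv2 hneg).1)
    · push_cast
      exact hacross
  · have hexp := exponent_le hρ hρ1 h.wait_le h.time_le
    have hnew : |crd τ (k + 1) (x (t + 1)) - 1 / 2|
        ≤ 1 / 2 * Real.exp (γ / L / 2 * (0 - wait (γ / L) (k + 1))) :=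
      hacross.trans (mul_le_mul_of_nonneg_left (Real.exp_le_exp.2 hexp) (by norm_num))
    have hmem : crd τ (k + 1) (x (t + 1)) ∈ Set.Icc (0 : ℝ) 1 := by
      refine mem_Icc_of_abs_le (hnew.trans (half_exp_le_half ?_))
      nlinarith [(le_wait hρ hρ1 (k + 1)).2]
    rcases h.le_n.eq_or_lt with hn | hn
    · refine .inr (.inr ⟨k, hn, h.wait_le.trans ?_, ⟨h2.le, hu2⟩, hmem⟩)
      exact_mod_cast (by omega : N ≤ t + 1)
    · refine .inl ⟨k + 1, 0, hn, by omega, hmem, ?_, by simpa using hnew⟩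
      rw [add_assoc, one_add_one_eq_two, crd_add_two, abs_le]
      simp only [Nat.cast_zero, mul_zero, Real.exp_zero]
      constructor <;> linarith

lemma InFinal.succ {n : ℕ} {f : Plane → ℝ} (hf : IsObjective γ L τ n f) (hτ : 0 < τ) (hL : 0 < L)
    {x : ℕ → Plane} (hx : IsGradientDescent f (1 / (4 * L)) x) {t k : ℕ}
    (h : InFinal (γ / L) τ n t (x t) k) : InFinal (γ / L) τ n (t + 1) (x (t + 1)) k := by
  have hmem := h.mem
  have hacr := h.across
  obtain ⟨hu, hv⟩ := hx.crd_succ hf hτ hL h.eq_n.le ⟨⟨by linarith [hmem.1], hmem.2⟩, hacr⟩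
  rw [if_pos h.eq_n, slope_of_mem_two_three _ _ _ hmem] at hu
  rw [if_pos h.eq_n, crossSlope_eq _ _ _ hacr] at hv
  refine ⟨h.eq_n, h.wait_le.trans (by exact_mod_cast Nat.le_succ t), ?_, ?_⟩
  · rw [hu]
    constructor <;> linarith [hmem.1, hmem.2]
  · rw [hv]
    constructor <;> linarith [hacr.1, hacr.2]

lemma inv_of_mem_block_one (hτ : 0 < τ) {ρ : ℝ} (hρ : 0 < ρ) (hρ1 : ρ ≤ 1 / 2) {n : ℕ} (hn : 2 ≤ n)
    {x : Plane} (hx : x ∈ block τ 1) (h : |x 0 - s₁ τ 1| ≤ τ / (2 * Real.exp 1 ^ 2)) :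
    Inv ρ τ n 0 x := by
  obtain ⟨hu, hv⟩ := (mem_block_iff hτ 0 x).1 hx
  have h0 := crd_two_mul hτ 0 x
  have hs : s₁ τ 1 = τ / 2 := by simp [s₁, left]
  simp only [mul_zero, Nat.cast_zero, add_zero] at h0
  rw [h0, hs, show τ * crd τ 0 x - τ / 2 = τ * (crd τ 0 x - 1 / 2) by ring, abs_mul,
    abs_of_pos hτ] at h
  refine .inl ⟨0, 0, hn, le_rfl, hu, ?_, ?_⟩
  · simp only [Nat.cast_zero, mul_zero, Real.exp_zero]
    rw [abs_le]
    constructor <;> linarith [hv.1, hv.2]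
  · have h1 : |crd τ 0 x - 1 / 2| ≤ 1 / 2 * Real.exp (-2) := by
      refine le_of_mul_le_mul_left (h.trans_eq ?_) hτ
      rw [← Real.exp_nat_mul, Real.exp_neg]
      norm_num
      field_simp
    refine h1.trans (mul_le_mul_of_nonneg_left (Real.exp_le_exp.2 ?_) (by norm_num))
    have e : ρ * wait ρ 0 = 1 + 6 * ρ := by
      rw [wait, zero_add, pow_one, mul_add, mul_one_div_cancel hρ.ne']
      ring
    push_cast
    linarith

lemma IsGradientDescent.inv {n : ℕ} {f : Plane → ℝ} (hf : IsObjective γ L τ n f) (hτ : 0 < τ)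
    (hγ : 0 < γ) (hL : 2 * γ ≤ L) (hn : 2 ≤ n) {x : ℕ → Plane}
    (hx : IsGradientDescent f (1 / (4 * L)) x) (hx0 : x 0 ∈ block τ 1)
    (h : |x 0 0 - s₁ τ 1| ≤ τ / (2 * Real.exp 1 ^ 2)) (t : ℕ) : Inv (γ / L) τ n t (x t) := by
  have hL0 : 0 < L := by linarith
  induction t with
  | zero =>
    exact inv_of_mem_block_one hτ (div_pos hγ hL0) (by rw [div_le_iff₀ hL0]; linarith) hn hx0 h
  | succ t ih =>
    rcases ih with ⟨k, N, ih⟩ | ⟨k, N, s, ih⟩ | ⟨k, ih⟩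
    · exact ih.succ hf hτ hγ hL hx
    · exact ih.succ hf hτ hγ hL hx
    · exact .inr (.inr ⟨k, ih.succ hf hτ hL0 hx⟩)

lemma Inv.mem_region (hτ : 0 < τ) {ρ : ℝ} (hρ : 0 < ρ) (hρ1 : ρ ≤ 1 / 2) {n t : ℕ} (hn : 2 ≤ n)
    {x : Plane} (h : Inv ρ τ n t x) : x ∈ region τ n := by
  rw [mem_region_iff hτ hn]
  rcases h with ⟨k, N, h⟩ | ⟨k, N, s, h⟩ | ⟨k, h⟩
  · exact ⟨k, h.le_n, h.mem_strip⟩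
  · exact ⟨k, h.le_n, h.mem_strip hρ hρ1⟩
  · exact ⟨k, h.eq_n.le, ⟨by linarith [h.mem.1], h.mem.2⟩, h.across⟩

/-- A strip before the last one does not meet the final block. -/
lemma eq_of_mem_strip_of_mem_block (hτ : 0 < τ) {j k : ℕ} (hk : k ≤ j) {x : Plane}
    (hx : x ∈ strip τ k) (hb : x ∈ block τ (j + 2)) : k = j := by
  by_contra hne
  obtain ⟨d, rfl⟩ : ∃ d, j = k + d + 1 := ⟨j - k - 1, by omega⟩
  linarith [((mem_block_succ_iff hτ _ x).1 hb).1.1, (crd_of_mem_strip hx d).2]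

lemma Inv.wait_le (hτ : 0 < τ) {ρ : ℝ} (hρ : 0 < ρ) (hρ1 : ρ ≤ 1 / 2) {j t : ℕ} {x : Plane}
    (h : Inv ρ τ (j + 2) t x) (hx : x ∈ block τ (j + 2)) : wait ρ j ≤ t := by
  rcases h with ⟨k, N, h⟩ | ⟨k, N, s, h⟩ | ⟨k, h⟩
  · have hk := eq_of_mem_strip_of_mem_block hτ (by have := h.le_n; omega) h.mem_strip hx
    subst hk
    linarith [h.mem.2, ((mem_block_succ_iff hτ _ x).1 hx).1.1]
  · have hk := eq_of_mem_strip_of_mem_block hτ (by have := h.le_n; omega) (h.mem_strip hρ hρ1) hx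
    subst hk
    exact h.wait_le.trans (by exact_mod_cast h.le_t)
  · have hk : k = j := by have := h.eq_n; omega
    subst hk
    exact h.wait_le

end Staircase

end

theorem mainTheorem1 :
    ∃ c : ℝ, 0 < c ∧
      ∀ (n : ℕ) (γ L τ : ℝ), 2 ≤ n → 0 < γ → 2 * γ ≤ L → 0 < τ →
        -- the construction is possible
        (∃ f : Plane → ℝ, IsObjective γ L τ n f) ∧
        ∀ f : Plane → ℝ, IsObjective γ L τ n f →
          -- `n - 1` saddle points, and a single local minimum in the region, in the final block
          (∀ i, 1 ≤ i → i < n → IsSaddlePoint f (center τ i)) ∧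
          (∀ z ∈ region τ n, IsLocalMin f z ↔ z = center τ n) ∧
          ∀ x : ℕ → Plane, IsGradientDescent f (1 / (4 * L)) x →
            x 0 ∈ block τ 1 → |x 0 0 - s₁ τ 1| ≤ τ / (2 * Real.exp 1 ^ 2) →
              -- the iterates never leave the region
              (∀ t, x t ∈ region τ n) ∧
              -- the final block is not reached before time `Ω((L / γ) ^ n)`
              (∀ t, x t ∈ block τ n → c * (γ / L) * (L / γ) ^ n ≤ (t : ℝ)) := by
  refine ⟨1, one_pos, fun n γ L τ hn hγ hL hτ => ?_⟩
  have hL0 : 0 < L := by linarith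
  have hρ : 0 < γ / L := div_pos hγ hL0
  have hρ1 : γ / L ≤ 1 / 2 := by rw [div_le_iff₀ hL0]; linarith
  refine ⟨⟨_, isObjective_extension hτ hL0 hn⟩, fun f hf => ⟨fun i h1 h2 => ?_, fun z hz =>
    ⟨hf.eq_center_of_isLocalMin hτ hγ hL hn hz, ?_⟩, fun x hx hx0 hx1 => ?_⟩⟩
  · obtain ⟨k, rfl⟩ : ∃ k, i = k + 1 := ⟨i - 1, by omega⟩
    exact hf.isSaddlePoint hτ hγ hL0 h2
  · obtain ⟨k, rfl⟩ : ∃ k, n = k + 1 := ⟨n - 1, by omega⟩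
    rintro rfl
    exact hf.isLocalMin_center hτ hL0
  · have hinv := hx.inv hf hτ hγ hL hn hx0 hx1
    refine ⟨fun t => (hinv t).mem_region hτ hρ hρ1 hn, fun t ht => ?_⟩
    obtain ⟨j, rfl⟩ : ∃ j, n = j + 2 := ⟨n - 2, by omega⟩
    refine le_trans ?_ ((hinv t).wait_le hτ hρ hρ1 ht)
    rw [wait, one_div_div, one_mul, pow_succ' (L / γ) (j + 1), ← mul_assoc,
      div_mul_div_cancel₀ hL0.ne', div_self hγ.ne', one_mul]
    linarith
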